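/- Let $A$ be a nonzero $C^*$-algebra and $\alpha$ an automorphism of $A$. A covariant partial-isometric representation of $(A,\alpha)$ in $M$ (where $M=B(H)$ for a Hilbert space $H$, or $M=M(B)$ is the multiplier algebra of a $C^*$-algebra $B$) is a pair $(\pi,V)$ consisting of a nondegenerate homomorphism $\pi$ of $A$ into $B(H)$, respectively into $B$, and a map $V:\mathbb N\to M$ whose values $V_n$ are partial isometries with $V_{n+m}=V_nV_m$, such that $\pi(\alpha^n(a))=V_n\pi(a)V_n^*$ and $V_n^*V_n\pi(a)=\pi(a)V_n^*V_n$ for all $a\in A$, $n\in\mathbb N$. A partial-isometric crossed product $A\times_\alpha^{\mathrm{piso}}\mathbb N$ is a triple $(B,j_A,v)$ of a $C^*$-algebra $B$ and a covariant partial-isometric representation $(j_A,v)$ of $(A,\alpha)$ in $M(B)$ such that $B$ is the closed linear span of the elements $v_n^*j_A(a)v_m$ ($n,m\in\mathbb N$, $a\in A$), and such that for every covariant partial-isometric representation $(\pi,V)$ of $(A,\alpha)$ on a Hilbert space $H$ there is a nondegenerate representation $\sigma:B\to B(H)$ with $\sigma\circ j_A=\pi$ and $\overline\sigma(v_n)=V_n$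 for all $n$, where $\overline\sigma$ is the extension of $\sigma$ to $M(B)$. Then a partial-isometric crossed product of $(A,\alpha)$ exists, and no partial-isometric crossed product $B=A\times_\alpha^{\mathrm{piso}}\mathbb N$ of $(A,\alpha)$ is simple, that is, $B$ has a closed two-sided ideal other than $0$ and $B$. More precisely, $B$ has a closed two-sided ideal $I$ with $0\neq I\neq B$ that is isomorphic to $\mathcal K(\ell^2(\mathbb N))\otimes A$ and whose quotient $B/I$ is isomorphic to the classical crossed product $A\times_\alpha\mathbb Z$. -/

import Mathlib

open scoped TensorProduct MultiplierAlgebra InnerProductSpace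

universe u

noncomputable section

namespace Piso

/-- A map `π` from a C*-algebra into the bounded operators on a Hilbert space is *nondegenerate*
if the vectors `π a h` span a dense subspace. -/
def NondegenerateRep {A H : Type*} [NonUnitalCStarAlgebra A]
    [NormedAddCommGroup H] [InnerProductSpace ℂ H] [CompleteSpace H]
    (π : A →⋆ₙₐ[ℂ] (H →L[ℂ] H)) : Prop :=
  Dense (Submodule.span ℂ {x : H | ∃ (a : A) (h : H), x = π a h} : Set H)

/-- A homomorphism `j : A → B` of C*-algebras is *nondegenerate* if the products `j a * b` span a
dense subspace of `B`. -/
def NondegenerateHom {A B : Type*} [NonUnitalCStarAlgebra A] [NonUnitalCStarAlgebra B]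
    (j : A →⋆ₙₐ[ℂ] B) : Prop :=
  Dense (Submodule.span ℂ {x : B | ∃ (a : A) (b : B), x = j a * b} : Set B)

/-- `V` is a *partial-isometric representation* of the additive semigroup `ℕ` in a unital
C*-algebra `M` (the bounded operators on a Hilbert space, or a multiplier algebra): every `V n` is
a partial isometry and `V (n + m) = V n * V m`. -/
structure IsPartialIsometricRep {M : Type*} [CStarAlgebra M] (V : ℕ → M) : Prop where
  partialIsometry : ∀ n, V n * star (V n) * V n = V n
  map_add : ∀ n m, V (n + m) = V n * V m

/-- The covariance relations for a pair `(π, V)`, where `V` is a partial-isometric representation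
of `ℕ`: `π (αⁿ a) = Vₙ π(a) Vₙ*` and `Vₙ* Vₙ π(a) = π(a) Vₙ* Vₙ`. -/
structure IsPisoCovariant {A M : Type*} [NonUnitalCStarAlgebra A] [CStarAlgebra M]
    (α : A ≃⋆ₐ[ℂ] A) (π : A →⋆ₙₐ[ℂ] M) (V : ℕ → M) : Prop where
  rep : IsPartialIsometricRep V
  covariant : ∀ n a, π ((α ^ n) a) = V n * π a * star (V n)
  commute : ∀ n a, star (V n) * V n * π a = π a * (star (V n) * V n)

/-- `(B, j, v)` is a *partial-isometric crossed product* of the system `(A, α)`.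

In `universal`, the equation `σ (vₙ b) = Vₙ σ(b)` for all `b` says that the (unique) extension of
the nondegenerate representation `σ` to the multiplier algebra sends `vₙ` to `Vₙ`; here
`(v n).fst b` is the product `vₙ b ∈ B`. -/
structure IsPisoCrossedProduct {A B : Type u} [NonUnitalCStarAlgebra A] [NonUnitalCStarAlgebra B]
    (α : A ≃⋆ₐ[ℂ] A) (j : A →⋆ₙₐ[ℂ] B) (v : ℕ → 𝓜(ℂ, B)) : Prop where
  nondegenerate : NondegenerateHom j
  covariant : IsPisoCovariant α ((DoubleCentralizer.coeHom (𝕜 := ℂ) (A := B)).comp j) v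
  universal : ∀ (H : Type u) [NormedAddCommGroup H] [InnerProductSpace ℂ H] [CompleteSpace H]
    (π : A →⋆ₙₐ[ℂ] (H →L[ℂ] H)) (V : ℕ → (H →L[ℂ] H)),
    NondegenerateRep π → IsPisoCovariant α π V →
    ∃ σ : B →⋆ₙₐ[ℂ] (H →L[ℂ] H), NondegenerateRep σ ∧ (∀ a, σ (j a) = π a) ∧
      ∀ n b, σ ((v n).fst b) = V n * σ b
  spanned : Dense (Submodule.span ℂ
    {b : B | ∃ (n m : ℕ) (a : A), (b : 𝓜(ℂ, B)) = star (v n) * (j a : 𝓜(ℂ, B)) * v m} : Set B)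

/-- `(C, i, w)` is a *(classical) crossed product* `A ×_α ℤ` of the system `(A, α)`. Unitary
representations of `ℤ` are written `n ↦ wⁿ` for a single unitary `w`, and
`i (α a) = w i(a) w*` is then equivalent to `i (αⁿ a) = wⁿ i(a) (wⁿ)*` for all `n : ℤ`. -/
structure IsCrossedProduct {A C : Type u} [NonUnitalCStarAlgebra A] [NonUnitalCStarAlgebra C]
    (α : A ≃⋆ₐ[ℂ] A) (i : A →⋆ₙₐ[ℂ] C) (w : unitary 𝓜(ℂ, C)) : Prop where
  nondegenerate : NondegenerateHom i
  covariant : ∀ a, (i (α a) : 𝓜(ℂ, C)) = (w : 𝓜(ℂ, C)) * (i a : 𝓜(ℂ, C)) * star (w : 𝓜(ℂ, C))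
  universal : ∀ (H : Type u) [NormedAddCommGroup H] [InnerProductSpace ℂ H] [CompleteSpace H]
    (π : A →⋆ₙₐ[ℂ] (H →L[ℂ] H)) (U : unitary (H →L[ℂ] H)),
    NondegenerateRep π →
    (∀ a, π (α a) = (U : H →L[ℂ] H) * π a * star (U : H →L[ℂ] H)) →
    ∃ σ : C →⋆ₙₐ[ℂ] (H →L[ℂ] H), NondegenerateRep σ ∧ (∀ a, σ (i a) = π a) ∧
      ∀ c, σ ((w : 𝓜(ℂ, C)).fst c) = (U : H →L[ℂ] H) * σ c
  spanned : Dense (Submodule.span ℂ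
    {c : C | ∃ (n : ℤ) (a : A),
      (c : 𝓜(ℂ, C)) = (i a : 𝓜(ℂ, C)) * ((w ^ n : unitary 𝓜(ℂ, C)) : 𝓜(ℂ, C))} : Set C)

/-- A C*-algebra is *simple* if it has no closed two-sided ideal besides `0` and itself. -/
def IsSimpleCStar (B : Type*) [NonUnitalCStarAlgebra B] : Prop :=
  ∀ I : TwoSidedIdeal B, IsClosed (I : Set B) → I = ⊥ ∨ I = ⊤

/-- The Hilbert space `ℓ²(ℕ)`. -/
abbrev Ell2 : Type := lp (fun _ : ℕ => ℂ) 2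

/-- The adjoint of a compact operator on a Hilbert space is compact. -/
theorem isCompactOperator_star {H : Type*} [NormedAddCommGroup H] [InnerProductSpace ℂ H]
    [CompleteSpace H] {T : H →L[ℂ] H} (hT : IsCompactOperator T) :
    IsCompactOperator (star T : H →L[ℂ] H) := by
  have hc : IsCompactOperator (T * star T : H →L[ℂ] H) := hT.comp_clm (star T)
  have hc' := hc.isCompact_closure_image_closedBall (f := ((T * star T : H →L[ℂ] H) : H →ₗ[ℂ] H)) 1
  refine (isCompactOperator_iff_isCompact_closure_image_closedBall
    ((star T : H →L[ℂ] H) : H →ₗ[ℂ] H) one_pos).2 ?_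
  have htb : TotallyBounded ((fun x => T (star T x)) '' Metric.closedBall (0 : H) 1) :=
    hc'.totallyBounded.subset subset_closure
  refine TotallyBounded.isCompact_of_isClosed (TotallyBounded.closure ?_) isClosed_closure
  rw [Metric.totallyBounded_iff]
  intro ε hε
  obtain ⟨t, hts, htf, htc⟩ :=
    Metric.finite_approx_of_totallyBounded htb (ε ^ 2 / 2) (by positivity)
  have hts' : ∀ y ∈ t, ∃ x ∈ Metric.closedBall (0 : H) 1, T (star T x) = y := fun y hy => hts hy
  choose! g hgb hgy using hts'
  refine ⟨(fun y => star T (g y)) '' t, htf.image _, ?_⟩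
  rintro _ ⟨x, hx, rfl⟩
  obtain ⟨y, hy, hxy⟩ := Set.mem_iUnion₂.1 (htc ⟨x, hx, rfl⟩)
  refine Set.mem_iUnion₂.2 ⟨_, ⟨y, hy, rfl⟩, ?_⟩
  replace hgb := hgb y hy
  replace hgy := hgy y hy
  rw [Metric.mem_ball, dist_eq_norm] at hxy ⊢
  rw [← hgy] at hxy
  simp only [← map_sub] at hxy
  change ‖star T x - star T (g y)‖ < ε
  rw [← map_sub]
  have hz : ‖x - g y‖ ≤ 2 := by
    have h1 := mem_closedBall_zero_iff.1 hx
    have h2 := mem_closedBall_zero_iff.1 hgb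
    linarith [norm_sub_le x (g y)]
  have hsq : ‖star T (x - g y)‖ ^ 2 ≤ ‖T (star T (x - g y))‖ * ‖x - g y‖ := by
    have h := ContinuousLinearMap.adjoint_inner_left T (star T (x - g y)) (x - g y)
    rw [← ContinuousLinearMap.star_eq_adjoint, inner_self_eq_norm_sq_to_K] at h
    have h' := norm_inner_le_norm (𝕜 := ℂ) (x - g y) (T (star T (x - g y)))
    rw [← h] at h'
    simpa [mul_comm] using h'
  have : ‖star T (x - g y)‖ ^ 2 < ε ^ 2 := by
    nlinarith [norm_nonneg (T (star T (x - g y))), norm_nonneg (x - g y)]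
  exact lt_of_pow_lt_pow_left₀ 2 hε.le this

/-- `K(H)`, the C*-algebra of compact operators on the Hilbert space `H`. -/
def compactOperators (H : Type*) [NormedAddCommGroup H] [InnerProductSpace ℂ H]
    [CompleteSpace H] : NonUnitalStarSubalgebra ℂ (H →L[ℂ] H) where
  carrier := {T | IsCompactOperator T}
  add_mem' hS hT := IsCompactOperator.add hS hT
  zero_mem' := isCompactOperator_zero
  smul_mem' c _ hT := IsCompactOperator.smul hT c
  mul_mem' {_ T} hS _ := IsCompactOperator.comp_clm hS T
  star_mem' hT := isCompactOperator_star hT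

/-- `μ : C ⊙ A → B` is an injective `*`-homomorphism from the algebraic tensor product of the
`*`-algebras `C` and `A` into the C*-algebra `B` (a linear map on `C ⊙ A` is a `*`-homomorphism
as soon as it is so on elementary tensors). The closure of the range of `μ` is then a
completion of `C ⊙ A` in a C*-norm. If `C = K(H)`, which is nuclear, there is only one C*-norm on
`C ⊙ A`, so that this closure is a copy of the C*-tensor product `K(H) ⊗ A`. -/
structure IsTensorEmbedding {C A B : Type*} [NonUnitalRing C] [StarRing C] [Module ℂ C]
    [NonUnitalCStarAlgebra A] [NonUnitalCStarAlgebra B] (μ : C ⊗[ℂ] A →ₗ[ℂ] B) : Prop where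
  injective : Function.Injective μ
  map_mul : ∀ (S T : C) (a b : A), μ ((S * T) ⊗ₜ[ℂ] (a * b)) = μ (S ⊗ₜ[ℂ] a) * μ (T ⊗ₜ[ℂ] b)
  map_star : ∀ (S : C) (a : A), μ (star S ⊗ₜ[ℂ] star a) = star (μ (S ⊗ₜ[ℂ] a))

end Piso

end

noncomputable section

namespace Piso

open Filter Topology

/-! Since every `αⁿ` is onto, covariance together with nondegeneracy forces `Vₙ Vₙ* = 1`: the
projection `Vₙ Vₙ*` fixes each `π(αⁿ b) = Vₙ π(b) Vₙ*`, and hence a dense set. Thus `V` consists of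
powers of one coisometry with `Vₙ π(a) = π(αⁿ a) Vₙ`, so products of the elements `Vₙ* π(a) Vₘ` are
again of this form. A crossed product exists because one can sum enough covariant representations,
one for each seminorm they induce on formal combinations of these elements, and take the closed span
(`IsToeplitz.isPisoCrossedProduct`).

The ideal comes from the defect projection `p = 1 - V₁* V₁`. It commutes with `π(A)` and satisfies
`Vₙ p = 0` for `n > 0`, so the elements `Vₙ* π(a) p Vₘ` multiply like `eₙₘ ⊗ a`. A finite matrix `T`
tensored with `a` goes to a product of values of two `*`-homomorphisms, which gives the bound `‖T‖
‖a‖` (`norm_truncTensor_le`) and lets the map extend to compact `T` by truncation. Compressing by `p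
Vₙ` and `Vₘ* p` recovers the matrix coefficients, so the map is injective once `a ↦ j(a) p` is. The
latter is detected in the backward shift representation on `ℓ²(ℕ, H)`, where `p` is the projection
onto coordinate zero.

The same ideal has an analytic description: it consists of the `b` with `b v_N* → 0`. Matrix units
satisfy this, since `p v_k* = 0` for `k > 0`; conversely `b (1 - v_N* v_N)` lies in the span of
matrix units because `1 - v_N* v_N = ∑_{k<N} v_k* p v_k`, and it tends to `b`
(`mem_defectIdeal_of_mem_vanishing`). From the analytic description follow properness, as `‖j(a)
v_N*‖ = ‖a‖`, and the C*-identity of the quotient norm, as the class of `b` has norm at most `‖b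
v_N*‖`.

Modulo the ideal `v₁* v₁ = 1`, so `v₁` becomes a unitary. Conversely, a covariant unitary
representation is a Toeplitz pair, and the representation of `B` it induces kills the ideal because
`‖σ(b)‖ ≤ ‖b v_N*‖` when `σ` makes the `v_N` unitary. Hence the quotient has the universal property
of `A ×_α ℤ`. -/

/-- A *Toeplitz pair*: the covariance relations satisfied by a covariant partial-isometric
representation whose isometric part is nondegenerate, in which every `V n` is a coisometry. -/
structure IsToeplitz {A M : Type*} [NonUnitalCStarAlgebra A] [CStarAlgebra M]
    (α : A ≃⋆ₐ[ℂ] A) (π : A →⋆ₙₐ[ℂ] M) (V : ℕ → M) : Prop where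
  rep_zero : V 0 = 1
  rep_add : ∀ n m, V (n + m) = V n * V m
  mul_star : ∀ n, V n * star (V n) = 1
  intertwine : ∀ n a, V n * π a = π ((α ^ n) a) * V n

/-- The defect projection `1 - V₁* V₁`. -/
def defect {M : Type*} [CStarAlgebra M] (V : ℕ → M) : M := 1 - star (V 1) * V 1

/-! ### Word calculus for Toeplitz pairs. -/

namespace IsToeplitz

variable {A M : Type*} [NonUnitalCStarAlgebra A] [CStarAlgebra M]
  {α : A ≃⋆ₐ[ℂ] A} {π : A →⋆ₙₐ[ℂ] M} {V : ℕ → M}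

theorem of_isPisoCovariant (h : IsPisoCovariant α π V) (hV : ∀ n, V n * star (V n) = 1) :
    IsToeplitz α π V where
  rep_zero := by
    have h0 := h.rep.map_add 0 0
    calc V 0 = V 0 * (V 0 * star (V 0)) := by rw [hV, mul_one]
      _ = (V 0 * V 0) * star (V 0) := (mul_assoc _ _ _).symm
      _ = 1 := by rw [← h0, hV]
  rep_add := h.rep.map_add
  mul_star := hV
  intertwine n a := by
    rw [h.covariant, mul_assoc _ (star (V n)), mul_assoc (V n), ← h.commute, ← mul_assoc,
      ← mul_assoc, hV, one_mul]

theorem intertwine_star (h : IsToeplitz α π V) (n : ℕ) (a : A) :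
    π a * star (V n) = star (V n) * π ((α ^ n) a) := by
  have := congrArg star (h.intertwine n (star a))
  simpa only [star_mul, map_star, star_star] using this

theorem isPisoCovariant (h : IsToeplitz α π V) : IsPisoCovariant α π V where
  rep := ⟨fun n => by rw [h.mul_star, one_mul], h.rep_add⟩
  covariant n a := by rw [h.intertwine, mul_assoc, h.mul_star, mul_one]
  commute n a := by
    rw [mul_assoc, h.intertwine, ← mul_assoc, ← h.intertwine_star, mul_assoc]

theorem star_mul_star (h : IsToeplitz α π V) (n m : ℕ) :
    star (V n) * star (V m) = star (V (m + n)) := by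
  rw [h.rep_add, star_mul]

theorem mul_star_of_le (h : IsToeplitz α π V) {m k : ℕ} (hmk : m ≤ k) :
    V m * star (V k) = star (V (k - m)) := by
  obtain ⟨l, rfl⟩ := Nat.exists_eq_add_of_le' hmk
  rw [← h.star_mul_star, ← mul_assoc, h.mul_star, one_mul, Nat.add_sub_cancel]

theorem mul_star_of_ge (h : IsToeplitz α π V) {m k : ℕ} (hmk : k ≤ m) :
    V m * star (V k) = V (m - k) := by
  obtain ⟨l, rfl⟩ := Nat.exists_eq_add_of_le' hmk
  rw [h.rep_add, mul_assoc, h.mul_star, mul_one, Nat.add_sub_cancel]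

/-- Truncated subtraction merges the two cases: one of the two exponents is `0`, and `V 0 = 1`. -/
theorem mul_star_eq (h : IsToeplitz α π V) (m k : ℕ) :
    V m * star (V k) = star (V (k - m)) * V (m - k) := by
  rcases le_total m k with hmk | hmk
  · rw [h.mul_star_of_le hmk, Nat.sub_eq_zero_of_le hmk, h.rep_zero, mul_one]
  · rw [h.mul_star_of_ge hmk, Nat.sub_eq_zero_of_le hmk, h.rep_zero, star_one, one_mul]

theorem norm_le_one (h : IsToeplitz α π V) (n : ℕ) : ‖V n‖ ≤ 1 := by
  nontriviality M
  have := CStarRing.norm_self_mul_star (x := V n)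
  rw [h.mul_star, norm_one] at this
  nlinarith [norm_nonneg (V n)]

/-- Since `x = (x Vₙ) Vₙ*`, neither multiplication by `Vₙ` nor by `Vₙ*` can lose norm here. -/
theorem norm_mul_right (h : IsToeplitz α π V) (x : M) (n : ℕ) : ‖x * V n‖ = ‖x‖ := by
  refine le_antisymm ?_ ?_
  · calc ‖x * V n‖ ≤ ‖x‖ * ‖V n‖ := norm_mul_le _ _
      _ ≤ ‖x‖ * 1 := by gcongr; exact h.norm_le_one n
      _ = ‖x‖ := mul_one _
  · calc ‖x‖ = ‖x * V n * star (V n)‖ := by rw [mul_assoc, h.mul_star, mul_one]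
      _ ≤ ‖x * V n‖ * ‖star (V n)‖ := norm_mul_le _ _
      _ ≤ ‖x * V n‖ * 1 := by gcongr; rw [norm_star]; exact h.norm_le_one n
      _ = ‖x * V n‖ := mul_one _

/-- The inner factor `Vₘ Vₖ*` collapses to a single power or adjoint power, which moves outwards
past `π` at the cost of a power of `α`. The formula depends on `α` alone, so it is the same for
every Toeplitz pair. -/
theorem gen_mul_gen (h : IsToeplitz α π V) (n m k l : ℕ) (a b : A) :
    (star (V n) * π a * V m) * (star (V k) * π b * V l) =
      star (V (k - m + n)) * π ((α ^ (k - m)) a * (α ^ (m - k)) b) * V (m - k + l) := by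
  calc _ = star (V n) * π a * (V m * star (V k)) * π b * V l := by simp only [mul_assoc]
    _ = star (V n) * (π a * star (V (k - m))) * (V (m - k) * π b) * V l := by
        rw [h.mul_star_eq]; simp only [mul_assoc]
    _ = (star (V n) * star (V (k - m))) * (π ((α ^ (k - m)) a) * π ((α ^ (m - k)) b)) *
          (V (m - k) * V l) := by
        rw [h.intertwine, h.intertwine_star]; simp only [mul_assoc]
    _ = _ := by rw [h.star_mul_star, ← h.rep_add, map_mul]

theorem star_gen (n m : ℕ) (a : A) :
    star (star (V n) * π a * V m) = star (V m) * π (star a) * V n := by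
  simp only [star_mul, star_star, map_star, mul_assoc]

/-! ### The defect projection and the matrix units -/

theorem mul_defect (h : IsToeplitz α π V) {n : ℕ} (hn : 0 < n) : V n * defect V = 0 := by
  obtain ⟨k, rfl⟩ := Nat.exists_eq_add_of_le' hn
  rw [h.rep_add, mul_assoc, defect, mul_sub, ← mul_assoc, h.mul_star]
  simp

theorem star_defect : star (defect V) = defect V := by
  simp [defect]

theorem defect_mul_star (h : IsToeplitz α π V) {n : ℕ} (hn : 0 < n) :
    defect V * star (V n) = 0 := by
  have := congrArg star (h.mul_defect hn)
  simpa [star_defect] using this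

theorem defect_mul_self (h : IsToeplitz α π V) : defect V * defect V = defect V := by
  conv_lhs => enter [1]; rw [defect]
  rw [sub_mul, mul_assoc, h.mul_defect one_pos]
  simp

theorem mul_defect_comm (h : IsToeplitz α π V) (a : A) : π a * defect V = defect V * π a := by
  have := h.isPisoCovariant.commute 1 a
  simp only [defect, mul_sub, sub_mul, mul_one, one_mul, this]

/-- Off the diagonal, `Vₙ Vₘ*` is a nontrivial power or adjoint power, and the defect kills it on
one side. All matrix unit relations reduce to this one. -/
theorem defect_sandwich (h : IsToeplitz α π V) (n m : ℕ) :
    defect V * V n * star (V m) * defect V = if n = m then defect V else 0 := by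
  split_ifs with hnm
  · subst hnm
    rw [mul_assoc (defect V), h.mul_star, mul_one, h.defect_mul_self]
  · rw [mul_assoc (defect V)]
    rcases lt_or_gt_of_ne hnm with hlt | hlt
    · rw [h.mul_star_of_le hlt.le, h.defect_mul_star (by omega), zero_mul]
    · rw [h.mul_star_of_ge hlt.le, mul_assoc, h.mul_defect (by omega), mul_zero]

/-- Telescoping: `Vₖ* (1 - V₁* V₁) Vₖ = Vₖ* Vₖ - Vₖ₊₁* Vₖ₊₁`. -/
theorem one_sub_star_mul (h : IsToeplitz α π V) (N : ℕ) :
    1 - star (V N) * V N = ∑ k ∈ Finset.range N, star (V k) * defect V * V k := by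
  induction N with
  | zero => simp [h.rep_zero]
  | succ N ih =>
    rw [Finset.sum_range_succ, ← ih, defect, add_comm N 1, h.rep_add, star_mul, mul_sub, sub_mul,
      mul_one]
    simp only [mul_assoc]
    abel

variable (π V) in
/-- The element `Vₙ* π(a) (1 - V₁* V₁) Vₘ`, which corresponds to `eₙₘ ⊗ a`. -/
def unit (n m : ℕ) (a : A) : M := star (V n) * π a * defect V * V m

theorem unit_add (n m : ℕ) (a b : A) : unit π V n m (a + b) = unit π V n m a + unit π V n m b := by
  simp only [unit, map_add, mul_add, add_mul]

theorem unit_smul (n m : ℕ) (c : ℂ) (a : A) : unit π V n m (c • a) = c • unit π V n m a := by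
  simp only [unit, map_smul, mul_smul_comm, smul_mul_assoc]

theorem unit_zero (n m : ℕ) : unit π V n m 0 = 0 := by
  simp [unit]

theorem star_unit (h : IsToeplitz α π V) (n m : ℕ) (a : A) :
    star (unit π V n m a) = unit π V m n (star a) := by
  simp only [unit, star_mul, star_star, star_defect]
  rw [← map_star]
  simp only [mul_assoc]
  rw [← mul_assoc (defect V), ← h.mul_defect_comm]
  simp only [mul_assoc]

theorem unit_mul_unit (h : IsToeplitz α π V) (n m k l : ℕ) (a b : A) :
    unit π V n m a * unit π V k l b = if m = k then unit π V n l (a * b) else 0 := by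
  have : unit π V n m a * unit π V k l b =
      star (V n) * π a * (defect V * V m * star (V k) * defect V) * π b * V l := by
    simp only [unit, mul_assoc]
    rw [← mul_assoc (π b), h.mul_defect_comm]
    simp only [mul_assoc]
  rw [this, h.defect_sandwich]
  split_ifs
  · rw [mul_assoc (star (V n) * π a), ← h.mul_defect_comm, unit, map_mul]
    simp only [mul_assoc]
  · simp

/-- Because `π(a) V₁* V₁ = V₁* π(α a) V₁`, the matrix units belong to the span of the generators,
although the defect projection itself may only be a multiplier. -/
theorem unit_eq_sub (h : IsToeplitz α π V) (n m : ℕ) (a : A) :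
    unit π V n m a =
      star (V n) * π a * V m - star (V (1 + n)) * π (α a) * V (1 + m) := by
  have h1 : π a * (star (V 1) * V 1) = star (V 1) * π (α a) * V 1 := by
    rw [← mul_assoc, h.intertwine_star, pow_one]
  rw [unit, mul_assoc (star (V n)), defect, mul_sub, h1, h.rep_add, h.rep_add, star_mul]
  simp only [mul_one, mul_sub, sub_mul, mul_assoc]

/-- If `m ≤ k` the power `Vₘ` is absorbed by `Vₖ*`; otherwise a positive power of `V` is left and
meets the defect. -/
theorem gen_mul_unit_one (h : IsToeplitz α π V) (n m k : ℕ) (a : A) :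
    (star (V n) * π a * V m) * (star (V k) * defect V * V k) =
      if m ≤ k then unit π V (k - m + n) k ((α ^ (k - m)) a) else 0 := by
  have : (star (V n) * π a * V m) * (star (V k) * defect V * V k) =
      star (V n) * π a * (V m * star (V k)) * defect V * V k := by simp only [mul_assoc]
  rw [this]
  split_ifs with hmk
  · rw [h.mul_star_of_le hmk, mul_assoc (star (V n)), h.intertwine_star, ← mul_assoc,
      h.star_mul_star, unit]
  · rw [h.mul_star_of_ge (by omega), mul_assoc (star (V n) * π a), h.mul_defect (by omega)]
    simp

theorem unit_mul_star_eq_zero (h : IsToeplitz α π V) {n m N : ℕ} (hm : m < N) (a : A) :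
    unit π V n m a * star (V N) = 0 := by
  rw [unit, mul_assoc _ (V m), h.mul_star_of_le hm.le, mul_assoc, h.defect_mul_star (by omega),
    mul_zero]

/-- Compression to the corner of the defect reads off one matrix entry; injectivity of the tensor
map rests on it. -/
theorem defect_unit_defect (h : IsToeplitz α π V) (n m k l : ℕ) (a : A) :
    defect V * V n * unit π V k l a * (star (V m) * defect V) =
      if n = k ∧ l = m then π a * defect V else 0 := by
  have : defect V * V n * unit π V k l a * (star (V m) * defect V) =
      (defect V * V n * star (V k) * defect V) * π a *
        (defect V * V l * star (V m) * defect V) := by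
    have h1 : π a * defect V = defect V * π a * defect V := by
      rw [← h.mul_defect_comm, mul_assoc, h.defect_mul_self]
    rw [unit, mul_assoc (star (V k)), h1]
    simp only [mul_assoc]
  rw [this, h.defect_sandwich, h.defect_sandwich]
  by_cases h1 : n = k <;> by_cases h2 : l = m <;> simp [h1, h2]
  rw [← h.mul_defect_comm, mul_assoc, h.defect_mul_self]

end IsToeplitz

/-! ### Matrix units and truncations on `ℓ²(ℕ)` -/

namespace Ell2

/-- The standard orthonormal basis of `ℓ²(ℕ)`. -/
def basis (n : ℕ) : Ell2 := lp.single 2 n (1 : ℂ)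

theorem inner_basis (n : ℕ) (x : Ell2) : ⟪basis n, x⟫_ℂ = x n := by
  simp [basis, lp.inner_single_left]

theorem basis_apply (n m : ℕ) : basis m n = if n = m then 1 else 0 := by
  simp [basis, lp.single_apply, Pi.single_apply]

/-- The rank one operators `eₙₘ`. -/
def matUnit (n m : ℕ) : Ell2 →L[ℂ] Ell2 := InnerProductSpace.rankOne ℂ (basis n) (basis m)

theorem matUnit_apply (n m : ℕ) (x : Ell2) : matUnit n m x = x m • basis n := by
  simp [matUnit, inner_basis]

/-- The matrix coefficients of an operator on `ℓ²(ℕ)`. -/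
def coeff (n m : ℕ) (T : Ell2 →L[ℂ] Ell2) : ℂ := T (basis m) n

theorem coeff_add (n m : ℕ) (S T : Ell2 →L[ℂ] Ell2) :
    coeff n m (S + T) = coeff n m S + coeff n m T := rfl

theorem coeff_smul (n m : ℕ) (c : ℂ) (T : Ell2 →L[ℂ] Ell2) :
    coeff n m (c • T) = c * coeff n m T := rfl

theorem coeff_zero (n m : ℕ) : coeff n m 0 = 0 := rfl

theorem coeff_star (n m : ℕ) (T : Ell2 →L[ℂ] Ell2) :
    coeff n m (star T) = star (coeff m n T) := by
  rw [coeff, coeff, ← inner_basis, ← inner_basis, ContinuousLinearMap.star_eq_adjoint,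
    ContinuousLinearMap.adjoint_inner_right, ← inner_conj_symm]
  rfl

theorem coeff_matUnit (n m k l : ℕ) :
    coeff n m (matUnit k l) = if n = k ∧ m = l then 1 else 0 := by
  simp only [coeff, matUnit_apply, basis_apply, lp.coeFn_smul, Pi.smul_apply, smul_eq_mul]
  by_cases h1 : n = k <;> by_cases h2 : m = l <;> simp [h1, h2, eq_comm]

/-- The projection onto the span of the first `N` basis vectors. -/
def trunc (N : ℕ) : Ell2 →L[ℂ] Ell2 := ∑ n ∈ Finset.range N, matUnit n n

theorem trunc_apply (N : ℕ) (x : Ell2) :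
    trunc N x = ∑ n ∈ Finset.range N, x n • basis n := by
  simp [trunc, matUnit_apply]

/-- With the truncation in the middle, the matrix product is a finite sum and no convergence
question arises. -/
theorem coeff_mul_trunc_mul (N n m : ℕ) (S T : Ell2 →L[ℂ] Ell2) :
    coeff n m (S * trunc N * T) = ∑ k ∈ Finset.range N, coeff n k S * coeff k m T := by
  simp only [coeff, mul_apply_eq_comp, trunc_apply, map_sum, map_smul, lp.coeFn_sum,
    Finset.sum_apply, lp.coeFn_smul, Pi.smul_apply, smul_eq_mul]
  exact Finset.sum_congr rfl fun k _ => mul_comm _ _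

theorem tendsto_trunc (x : Ell2) : Tendsto (fun N => trunc N x) atTop (𝓝 x) := by
  have h := (lp.hasSum_single (p := 2) (by norm_num) x).tendsto_sum_nat
  refine h.congr fun N => ?_
  rw [trunc_apply]
  refine Finset.sum_congr rfl fun n _ => ?_
  rw [basis, ← lp.single_smul, smul_eq_mul, mul_one]

theorem star_trunc (N : ℕ) : star (trunc N) = trunc N := by
  simp [trunc, matUnit, ContinuousLinearMap.star_eq_adjoint]

theorem trunc_apply_coord (N n : ℕ) (x : Ell2) : trunc N x n = if n < N then x n else 0 := by
  simp only [trunc_apply, lp.coeFn_sum, Finset.sum_apply, lp.coeFn_smul, Pi.smul_apply, smul_eq_mul,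
    basis_apply]
  simp

theorem trunc_mul_self (N : ℕ) : trunc N * trunc N = trunc N := by
  ext x n
  simp only [mul_apply_eq_comp, trunc_apply_coord]
  split_ifs <;> rfl

theorem norm_trunc_le (N : ℕ) : ‖trunc N‖ ≤ 1 := by
  have h := CStarRing.norm_star_mul_self (x := trunc N)
  rw [star_trunc, trunc_mul_self] at h
  by_contra! h1
  nlinarith

theorem coeff_trunc_mul_trunc (N n m : ℕ) (T : Ell2 →L[ℂ] Ell2) :
    coeff n m (trunc N * T * trunc N) = if n < N ∧ m < N then coeff n m T else 0 := by
  have : trunc N (basis m) = if m < N then basis m else 0 := by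
    ext n
    rw [trunc_apply_coord, basis_apply]
    by_cases h1 : n < N <;> by_cases h2 : m < N <;> simp [h1, h2, basis_apply]
    all_goals omega
  simp only [coeff, mul_apply_eq_comp, trunc_apply_coord, this]
  by_cases h1 : n < N <;> by_cases h2 : m < N <;> simp [h1, h2]

theorem ext_coeff {S T : Ell2 →L[ℂ] Ell2} (h : ∀ n m, coeff n m S = coeff n m T) : S = T := by
  have hb : ∀ m, S (basis m) = T (basis m) := fun m => lp.ext (funext fun n => h n m)
  ext1 x
  have hx : ∀ N, S (trunc N x) = T (trunc N x) := fun N => by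
    simp [trunc_apply, map_sum, map_smul, hb]
  refine tendsto_nhds_unique ((S.continuous.tendsto _).comp (tendsto_trunc x)) ?_
  exact ((T.continuous.tendsto _).comp (tendsto_trunc x)).congr fun N => (hx N).symm

/-- Truncations are contractions converging strongly, hence uniformly on totally bounded sets such
as the image of the unit ball under a compact operator. -/
theorem tendsto_trunc_mul {T : Ell2 →L[ℂ] Ell2} (hT : IsCompactOperator T) :
    Tendsto (fun N => trunc N * T) atTop (𝓝 T) := by
  have htb : TotallyBounded (T '' Metric.closedBall (0 : Ell2) 1) :=
    (hT.isCompact_closure_image_closedBall (f := (T : Ell2 →ₗ[ℂ] Ell2)) 1).totallyBounded.subset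
      subset_closure
  rw [Metric.tendsto_nhds]
  intro ε hε
  -- The error splits into three pieces of size at most `ε / 4`, which leaves room for a strict
  -- inequality.
  obtain ⟨t, -, htf, htc⟩ := Metric.finite_approx_of_totallyBounded htb (ε / 4) (by positivity)
  have hev : ∀ᶠ N in atTop, ∀ y ∈ t, dist (trunc N y) y < ε / 4 :=
    (htf.eventually_all (l := atTop)).2 fun y _ =>
      Metric.tendsto_nhds.1 (tendsto_trunc y) _ (by positivity)
  filter_upwards [hev] with N hN
  rw [dist_eq_norm]
  refine lt_of_le_of_lt (ContinuousLinearMap.opNorm_le_of_unit_norm (C := 3 * (ε / 4))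
    (by positivity) fun x hx => ?_) (by linarith)
  obtain ⟨y, hy, hxy⟩ := Set.mem_iUnion₂.1 (htc ⟨x, by simp [hx], rfl⟩)
  rw [Metric.mem_ball, dist_eq_norm] at hxy
  have h1 := hN y hy
  rw [dist_eq_norm] at h1
  have h2 : ‖trunc N (T x - y)‖ ≤ ‖T x - y‖ :=
    ((trunc N).le_opNorm _).trans (mul_le_of_le_one_left (norm_nonneg _) (norm_trunc_le N))
  have h3 : (trunc N * T - T) x = trunc N (T x - y) + (trunc N y - y) - (T x - y) := by
    simp only [sub_apply, mul_apply_eq_comp, map_sub]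
    abel
  rw [h3]
  calc _ ≤ ‖trunc N (T x - y)‖ + ‖trunc N y - y‖ + ‖T x - y‖ :=
        (norm_sub_le _ _).trans (by gcongr; exact norm_add_le _ _)
    _ ≤ 3 * (ε / 4) := by linarith

theorem tendsto_mul_trunc {T : Ell2 →L[ℂ] Ell2} (hT : IsCompactOperator T) :
    Tendsto (fun N => T * trunc N) atTop (𝓝 T) := by
  have h := (continuous_star.tendsto _).comp (tendsto_trunc_mul (isCompactOperator_star hT))
  rw [star_star] at h
  refine h.congr fun N => ?_
  simp [star_trunc]

theorem tendsto_trunc_mul_trunc {T : Ell2 →L[ℂ] Ell2} (hT : IsCompactOperator T) :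
    Tendsto (fun N => trunc N * T * trunc N) atTop (𝓝 T) := by
  have h1 : Tendsto (fun N => trunc N * (T * trunc N - T)) atTop (𝓝 0) := by
    refine squeeze_zero_norm (a := fun N => ‖T * trunc N - T‖) (fun N => ?_) ?_
    · exact (norm_mul_le _ _).trans (mul_le_of_le_one_left (norm_nonneg _) (norm_trunc_le N))
    · exact tendsto_iff_norm_sub_tendsto_zero.1 (tendsto_mul_trunc hT)
  have h2 := h1.add (tendsto_trunc_mul hT)
  rw [zero_add] at h2
  refine h2.congr fun N => ?_
  rw [mul_sub, mul_assoc]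
  abel

theorem isCompactOperator_matUnit (n m : ℕ) : IsCompactOperator (matUnit n m) := by
  have := (isCompactOperator_id (E := ℂ)).clm_comp (ContinuousLinearMap.toSpanSingleton ℂ (basis n))
  rw [matUnit, InnerProductSpace.rankOne_def']
  exact this.comp_clm (innerSL ℂ (basis m))

end Ell2

/-- The corner `P_N B(ℓ²) P_N`. -/
def Ell2.corner (N : ℕ) : NonUnitalStarSubalgebra ℂ (Ell2 →L[ℂ] Ell2) where
  carrier := {T | Ell2.trunc N * T = T ∧ T * Ell2.trunc N = T}
  add_mem' := by
    rintro S T ⟨h1, h2⟩ ⟨h3, h4⟩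
    exact ⟨by rw [mul_add, h1, h3], by rw [add_mul, h2, h4]⟩
  zero_mem' := ⟨mul_zero _, zero_mul _⟩
  smul_mem' := by
    rintro c T ⟨h1, h2⟩
    exact ⟨by rw [mul_smul_comm, h1], by rw [smul_mul_assoc, h2]⟩
  mul_mem' := by
    rintro S T ⟨h1, h2⟩ ⟨h3, h4⟩
    exact ⟨by rw [← mul_assoc, h1], by rw [mul_assoc, h4]⟩
  star_mem' := by
    rintro T ⟨h1, h2⟩
    exact ⟨by rw [← Ell2.star_trunc, ← star_mul, h2], by rw [← Ell2.star_trunc, ← star_mul, h1]⟩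

theorem Ell2.isClosed_corner (N : ℕ) : IsClosed (Ell2.corner N : Set (Ell2 →L[ℂ] Ell2)) :=
  (isClosed_eq (by fun_prop) continuous_id).inter (isClosed_eq (by fun_prop) continuous_id)

/-- Multiplication of matrices over a system of matrix units. -/
theorem sum_smul_mul_sum_smul {M : Type*} [CStarAlgebra M] {u w r : ℕ → ℕ → M}
    (hu : ∀ n m k l, u n m * w k l = if m = k then r n l else 0) (N : ℕ) (c d : ℕ → ℕ → ℂ) :
    (∑ n ∈ Finset.range N, ∑ m ∈ Finset.range N, c n m • u n m) *
        (∑ k ∈ Finset.range N, ∑ l ∈ Finset.range N, d k l • w k l) =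
      ∑ n ∈ Finset.range N, ∑ l ∈ Finset.range N,
        (∑ k ∈ Finset.range N, c n k * d k l) • r n l := by
  rw [Finset.sum_mul]
  refine Finset.sum_congr rfl fun n _ => ?_
  simp only [Finset.sum_smul]
  rw [Finset.sum_mul]
  conv_rhs => rw [Finset.sum_comm]
  refine Finset.sum_congr rfl fun m hm => ?_
  rw [Finset.mul_sum, Finset.sum_eq_single_of_mem m hm]
  · rw [Finset.mul_sum]
    refine Finset.sum_congr rfl fun l _ => ?_
    rw [smul_mul_smul_comm, hu n m m l, if_pos rfl]
  · intro k _ hk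
    rw [Finset.mul_sum]
    refine Finset.sum_eq_zero fun l _ => ?_
    rw [smul_mul_smul_comm, hu n m k l, if_neg hk.symm, smul_zero]

/-- Slice maps along a separating family of functionals separate the points of a tensor product. -/
theorem injective_of_slice {K E N ι : Type*} [AddCommGroup K] [Module ℂ K] [AddCommGroup E]
    [Module ℂ E] [AddCommGroup N] [Module ℂ N] (f : ι → K →ₗ[ℂ] ℂ)
    (hf : ∀ T, (∀ i, f i T = 0) → T = 0) (φ : K ⊗[ℂ] E →ₗ[ℂ] N)
    (hφ : ∀ x, φ x = 0 → ∀ i, TensorProduct.lid ℂ E ((f i).rTensor E x) = 0) :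
    Function.Injective φ := by
  classical
  refine (injective_iff_map_eq_zero φ).2 fun x hx => ?_
  -- Expand the second leg in a Hamel basis: the coordinates of `x` are elements of `K`, and
  -- applying `f i` to the `k`-th one gives the `k`-th coordinate of the slice.
  let b := Module.Basis.ofVectorSpace ℂ E
  have key : ∀ (y : K ⊗[ℂ] E) i k, b.repr (TensorProduct.lid ℂ E ((f i).rTensor E y)) k =
      f i (TensorProduct.equivFinsuppOfBasisRight b y k) := by
    intro y i k
    induction y with
    | zero => simp
    | add y z hy hz => simp only [map_add, Finsupp.add_apply, hy, hz]
    | tmul T a => simp [mul_comm]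
  apply (TensorProduct.equivFinsuppOfBasisRight b).injective
  rw [map_zero]
  ext1 k
  refine hf _ fun i => ?_
  rw [← key, hφ x hx]
  simp

/-- The matrix coefficients as linear functionals on the compact operators. -/
def Ell2.coeffₗ (p : ℕ × ℕ) : compactOperators Ell2 →ₗ[ℂ] ℂ where
  toFun T := Ell2.coeff p.1 p.2 (T : Ell2 →L[ℂ] Ell2)
  map_add' _ _ := rfl
  map_smul' _ _ := rfl

/-! ### The homomorphism from compact operators tensor `A`. -/

namespace IsToeplitz

variable {A M : Type*} [NonUnitalCStarAlgebra A] [CStarAlgebra M]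
  {α : A ≃⋆ₐ[ℂ] A} {π : A →⋆ₙₐ[ℂ] M} {V : ℕ → M}

variable (V) in
/-- The matrix units `Vₙ* (1 - V₁* V₁) Vₘ`. -/
def matUnit (n m : ℕ) : M := star (V n) * defect V * V m

theorem star_matUnit (n m : ℕ) : star (matUnit V n m) = matUnit V m n := by
  simp only [matUnit, star_mul, star_star, star_defect, mul_assoc]

theorem matUnit_mul_unit (h : IsToeplitz α π V) (n m k l : ℕ) (a : A) :
    matUnit V n m * unit π V k l a = if m = k then unit π V n l a else 0 := by
  have : matUnit V n m * unit π V k l a =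
      star (V n) * (defect V * V m * star (V k) * defect V) * π a * V l := by
    simp only [unit, matUnit]
    rw [mul_assoc (star (V k)), h.mul_defect_comm]
    simp only [mul_assoc]
  rw [this, h.defect_sandwich]
  split_ifs
  · rw [mul_assoc (star (V n)), ← h.mul_defect_comm, unit]
    simp only [mul_assoc]
  · simp

theorem matUnit_mul_matUnit (h : IsToeplitz α π V) (n m k l : ℕ) :
    matUnit V n m * matUnit V k l = if m = k then matUnit V n l else 0 := by
  have : matUnit V n m * matUnit V k l =
      star (V n) * (defect V * V m * star (V k) * defect V) * V l := by
    simp only [matUnit, mul_assoc]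
  rw [this, h.defect_sandwich]
  split_ifs
  · rfl
  · simp

/-- The representation of the corner `P_N B(ℓ²) P_N` by the matrix units `Vₙ* (1 - V₁* V₁) Vₘ`. -/
def cornerHom (h : IsToeplitz α π V) (N : ℕ) : Ell2.corner N →⋆ₙₐ[ℂ] M where
  toFun T := ∑ n ∈ Finset.range N, ∑ m ∈ Finset.range N,
    Ell2.coeff n m (T : Ell2 →L[ℂ] Ell2) • matUnit V n m
  map_smul' c T := by
    simp only [Finset.smul_sum, smul_smul]; rfl
  map_zero' := by simp [Ell2.coeff_zero]
  map_add' S T := by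
    simp only [← Finset.sum_add_distrib, ← add_smul]; rfl
  map_mul' S T := by
    -- An element of the corner absorbs the projection, so the product may be computed with finite
    -- matrices.
    have hST : ((S * T : Ell2.corner N) : Ell2 →L[ℂ] Ell2) =
        (S : Ell2 →L[ℂ] Ell2) * Ell2.trunc N * T := by
      rw [S.2.2]; rfl
    rw [sum_smul_mul_sum_smul h.matUnit_mul_matUnit]
    simp only [hST, Ell2.coeff_mul_trunc_mul]
  map_star' T := by
    simp only [star_sum, star_smul, star_matUnit]
    rw [Finset.sum_comm]
    refine Finset.sum_congr rfl fun n _ => Finset.sum_congr rfl fun m _ => ?_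
    rw [← Ell2.coeff_star]; rfl

/-- The diagonal homomorphism `a ↦ ∑_{k < N} e_kk ⊗ a`. -/
def diagHom (h : IsToeplitz α π V) (N : ℕ) : A →⋆ₙₐ[ℂ] M where
  toFun a := ∑ k ∈ Finset.range N, unit π V k k a
  map_smul' c a := by simp only [unit_smul, Finset.smul_sum]; rfl
  map_zero' := by simp [unit_zero]
  map_add' a b := by simp only [unit_add, Finset.sum_add_distrib]
  map_mul' a b := by
    simp only [Finset.sum_mul, Finset.mul_sum, h.unit_mul_unit]
    refine Finset.sum_congr rfl fun k hk => ?_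
    rw [Finset.sum_ite_eq' , if_pos hk]
  map_star' a := by simp only [star_sum, h.star_unit]

variable (π V) in
/-- The image of `P_N T P_N ⊗ a`. -/
def truncTensor (N : ℕ) (T : Ell2 →L[ℂ] Ell2) (a : A) : M :=
  ∑ n ∈ Finset.range N, ∑ m ∈ Finset.range N, Ell2.coeff n m T • unit π V n m a

theorem truncTensor_add_left (N : ℕ) (S T : Ell2 →L[ℂ] Ell2) (a : A) :
    truncTensor π V N (S + T) a = truncTensor π V N S a + truncTensor π V N T a := by
  simp only [truncTensor, Ell2.coeff_add, add_smul, Finset.sum_add_distrib]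

theorem truncTensor_smul_left (N : ℕ) (c : ℂ) (T : Ell2 →L[ℂ] Ell2) (a : A) :
    truncTensor π V N (c • T) a = c • truncTensor π V N T a := by
  simp only [truncTensor, Ell2.coeff_smul, mul_smul, Finset.smul_sum]

theorem truncTensor_add_right (N : ℕ) (T : Ell2 →L[ℂ] Ell2) (a b : A) :
    truncTensor π V N T (a + b) = truncTensor π V N T a + truncTensor π V N T b := by
  simp only [truncTensor, unit_add, smul_add, Finset.sum_add_distrib]

theorem truncTensor_smul_right (N : ℕ) (c : ℂ) (T : Ell2 →L[ℂ] Ell2) (a : A) :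
    truncTensor π V N T (c • a) = c • truncTensor π V N T a := by
  simp only [truncTensor, unit_smul, Finset.smul_sum, smul_comm c]

theorem truncTensor_mul (h : IsToeplitz α π V) (N : ℕ) (S T : Ell2 →L[ℂ] Ell2) (a b : A) :
    truncTensor π V N S a * truncTensor π V N T b =
      truncTensor π V N (S * Ell2.trunc N * T) (a * b) := by
  simp only [truncTensor, Ell2.coeff_mul_trunc_mul]
  exact sum_smul_mul_sum_smul (fun n m k l => h.unit_mul_unit n m k l a b) N _ _

theorem star_truncTensor (h : IsToeplitz α π V) (N : ℕ) (T : Ell2 →L[ℂ] Ell2) (a : A) :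
    star (truncTensor π V N T a) = truncTensor π V N (star T) (star a) := by
  simp only [truncTensor, star_sum, star_smul, h.star_unit, Ell2.coeff_star]
  exact Finset.sum_comm

/-- The element factors as the image of `P_N T P_N` under `cornerHom` times the image of `a` under
`diagHom`, and `*`-homomorphisms of C*-algebras are contractive. The bound does not depend on `N`.
-/
theorem norm_truncTensor_le (h : IsToeplitz α π V) (N : ℕ) (T : Ell2 →L[ℂ] Ell2) (a : A) :
    ‖truncTensor π V N T a‖ ≤ ‖T‖ * ‖a‖ := by
  -- Closedness makes the corner a C*-algebra, as contractivity of `cornerHom` requires.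
  have := Ell2.isClosed_corner N
  let S : Ell2.corner N := ⟨Ell2.trunc N * T * Ell2.trunc N, by
    constructor
    · rw [← mul_assoc, ← mul_assoc, Ell2.trunc_mul_self]
    · rw [mul_assoc, Ell2.trunc_mul_self]⟩
  have hS : ‖S‖ ≤ ‖T‖ := by
    calc ‖Ell2.trunc N * T * Ell2.trunc N‖ ≤ ‖Ell2.trunc N * T‖ * ‖Ell2.trunc N‖ := norm_mul_le _ _
      _ ≤ ‖Ell2.trunc N‖ * ‖T‖ * ‖Ell2.trunc N‖ := by gcongr; exact norm_mul_le _ _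
      _ ≤ 1 * ‖T‖ * 1 := by gcongr <;> exact Ell2.norm_trunc_le N
      _ = ‖T‖ := by ring
  have hprod : truncTensor π V N T a = h.cornerHom N S * h.diagHom N a := by
    -- The diagonal sum is rewritten with the coefficients of the identity matrix, so that matrix
    -- multiplication applies.
    have hdiag : h.diagHom N a = ∑ k ∈ Finset.range N, ∑ l ∈ Finset.range N,
        (if k = l then (1 : ℂ) else 0) • unit π V k l a := by
      change ∑ k ∈ Finset.range N, unit π V k k a = _
      refine Finset.sum_congr rfl fun k hk => ?_
      simp only [ite_smul, one_smul, zero_smul]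
      rw [Finset.sum_ite_eq, if_pos hk]
    rw [hdiag]
    change _ = (∑ n ∈ Finset.range N, ∑ m ∈ Finset.range N,
      Ell2.coeff n m (Ell2.trunc N * T * Ell2.trunc N) • matUnit V n m) * _
    rw [sum_smul_mul_sum_smul (fun n m k l => h.matUnit_mul_unit n m k l a)]
    refine Finset.sum_congr rfl fun n hn => Finset.sum_congr rfl fun l hl => ?_
    simp only [Ell2.coeff_trunc_mul_trunc, mul_ite, mul_one, mul_zero]
    rw [Finset.sum_ite_eq', if_pos hl,
      if_pos ⟨Finset.mem_range.1 hn, Finset.mem_range.1 hl⟩]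
  rw [hprod]
  calc _ ≤ ‖h.cornerHom N S‖ * ‖h.diagHom N a‖ := norm_mul_le _ _
    _ ≤ ‖S‖ * ‖a‖ := by
      gcongr
      · exact NonUnitalStarAlgHom.norm_apply_le (h.cornerHom N) S
      · exact NonUnitalStarAlgHom.norm_apply_le (h.diagHom N) a
    _ ≤ ‖T‖ * ‖a‖ := by gcongr

theorem truncTensor_trunc (N N' : ℕ) (hN : N ≤ N') (T : Ell2 →L[ℂ] Ell2) (a : A) :
    truncTensor π V N' (Ell2.trunc N * T * Ell2.trunc N) a = truncTensor π V N T a := by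
  simp only [truncTensor, Ell2.coeff_trunc_mul_trunc]
  symm
  refine Finset.sum_subset_zero_on_sdiff (Finset.range_mono hN) (fun n hn => ?_) fun n hn => ?_
  · simp only [Finset.mem_sdiff, Finset.mem_range] at hn
    simp [hn.2]
  · refine Finset.sum_subset_zero_on_sdiff (Finset.range_mono hN) (fun m hm => ?_) fun m hm => ?_
    · simp only [Finset.mem_sdiff, Finset.mem_range] at hm
      simp [hm.2]
    · rw [if_pos ⟨Finset.mem_range.1 hn, Finset.mem_range.1 hm⟩]

theorem truncTensor_neg_left (N : ℕ) (T : Ell2 →L[ℂ] Ell2) (a : A) :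
    truncTensor π V N (-T) a = -truncTensor π V N T a := by
  simpa using truncTensor_smul_left (π := π) (V := V) N (-1) T a

theorem truncTensor_sub_left (N : ℕ) (S T : Ell2 →L[ℂ] Ell2) (a : A) :
    truncTensor π V N (S - T) a = truncTensor π V N S a - truncTensor π V N T a := by
  rw [sub_eq_add_neg, truncTensor_add_left, truncTensor_neg_left, ← sub_eq_add_neg]

/-- Level `N` is also the level `n ≥ N` value at `P_N T P_N`, so the difference of the two levels is
controlled by `‖P_N T P_N - T‖`, which tends to zero for compact `T`. -/
theorem cauchySeq_truncTensor (h : IsToeplitz α π V) {T : Ell2 →L[ℂ] Ell2}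
    (hT : IsCompactOperator T) (a : A) : CauchySeq fun N => truncTensor π V N T a := by
  have hlim := tendsto_iff_norm_sub_tendsto_zero.1 (Ell2.tendsto_trunc_mul_trunc hT)
  have key : ∀ n N, N ≤ n → dist (truncTensor π V n T a) (truncTensor π V N T a) ≤
      ‖Ell2.trunc N * T * Ell2.trunc N - T‖ * ‖a‖ := fun n N hN => by
    rw [dist_comm, dist_eq_norm, ← truncTensor_trunc N n hN, ← truncTensor_sub_left]
    exact h.norm_truncTensor_le n _ a
  refine cauchySeq_of_le_tendsto_0
    (fun N => 2 * (‖Ell2.trunc N * T * Ell2.trunc N - T‖ * ‖a‖)) (fun n m N hn hm => ?_) ?_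
  · calc _ ≤ _ := dist_triangle_right _ _ (truncTensor π V N T a)
      _ ≤ _ := by linarith [key n N hn, key m N hm]
  · simpa using (hlim.mul_const ‖a‖).const_mul 2

variable (π V) in
/-- The image of `T ⊗ a`. -/
def tensor (T : Ell2 →L[ℂ] Ell2) (a : A) : M := limUnder atTop fun N => truncTensor π V N T a

theorem tendsto_tensor (h : IsToeplitz α π V) {T : Ell2 →L[ℂ] Ell2}
    (hT : IsCompactOperator T) (a : A) :
    Tendsto (fun N => truncTensor π V N T a) atTop (𝓝 (tensor π V T a)) :=
  (h.cauchySeq_truncTensor hT a).tendsto_limUnder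

/-- Truncated elements multiply with `P_N` inserted between `S` and `T`; compactness of `T` makes
this insertion negligible in norm. -/
theorem tensor_mul (h : IsToeplitz α π V) {S T : Ell2 →L[ℂ] Ell2}
    (hS : IsCompactOperator S) (hT : IsCompactOperator T) (a b : A) :
    tensor π V (S * T) (a * b) = tensor π V S a * tensor π V T b := by
  have hST : IsCompactOperator (S * T : Ell2 →L[ℂ] Ell2) := hS.comp_clm T
  refine tendsto_nhds_unique ?_ ((h.tendsto_tensor hS a).mul (h.tendsto_tensor hT b))
  have h0 : Tendsto (fun N => truncTensor π V N (S * Ell2.trunc N * T - S * T) (a * b))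
      atTop (𝓝 0) := by
    refine squeeze_zero_norm
      (a := fun N => ‖S‖ * ‖Ell2.trunc N * T - T‖ * ‖a * b‖) (fun N => ?_) ?_
    · refine (h.norm_truncTensor_le N _ _).trans ?_
      gcongr
      rw [mul_assoc, ← mul_sub]
      exact norm_mul_le _ _
    · have := tendsto_iff_norm_sub_tendsto_zero.1 (Ell2.tendsto_trunc_mul hT)
      simpa using (this.const_mul ‖S‖).mul_const ‖a * b‖
  have h1 := h0.add (h.tendsto_tensor hST (a * b))
  rw [zero_add] at h1
  refine h1.congr fun N => ?_
  rw [h.truncTensor_mul, ← truncTensor_add_left, sub_add_cancel]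

theorem star_tensor (h : IsToeplitz α π V) {T : Ell2 →L[ℂ] Ell2} (hT : IsCompactOperator T)
    (a : A) : tensor π V (star T) (star a) = star (tensor π V T a) := by
  refine tendsto_nhds_unique (h.tendsto_tensor (isCompactOperator_star hT) (star a)) ?_
  refine ((continuous_star.tendsto _).comp (h.tendsto_tensor hT a)).congr fun N => ?_
  exact h.star_truncTensor N T a

theorem tensor_matUnit (h : IsToeplitz α π V) (n m : ℕ) (a : A) :
    tensor π V (Ell2.matUnit n m) a = unit π V n m a := by
  refine tendsto_nhds_unique (h.tendsto_tensor (Ell2.isCompactOperator_matUnit n m) a) ?_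
  refine tendsto_const_nhds.congr' ?_
  filter_upwards [eventually_gt_atTop n, eventually_gt_atTop m] with N hn hm
  simp only [truncTensor, Ell2.coeff_matUnit, ite_smul, one_smul, zero_smul, ite_and]
  simp [hn, hm]

theorem tensor_mem (h : IsToeplitz α π V) {W : Submodule ℂ M} (hW : IsClosed (W : Set M))
    (hu : ∀ n m a, unit π V n m a ∈ W) {T : Ell2 →L[ℂ] Ell2} (hT : IsCompactOperator T)
    (a : A) : tensor π V T a ∈ W :=
  hW.mem_of_tendsto (h.tendsto_tensor hT a) (Eventually.of_forall fun _ =>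
    W.sum_mem fun _ _ => W.sum_mem fun _ _ => W.smul_mem _ (hu _ _ _))

/-- The compressed truncations are constant as soon as `N` exceeds both `n` and `m`. -/
theorem defect_tensor_defect (h : IsToeplitz α π V) (n m : ℕ) {T : Ell2 →L[ℂ] Ell2}
    (hT : IsCompactOperator T) (a : A) :
    defect V * V n * tensor π V T a * (star (V m) * defect V) =
      Ell2.coeff n m T • (π a * defect V) := by
  refine tendsto_nhds_unique
    (((h.tendsto_tensor hT a).const_mul (defect V * V n)).mul_const (star (V m) * defect V)) ?_
  refine tendsto_const_nhds.congr' ?_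
  filter_upwards [eventually_gt_atTop n, eventually_gt_atTop m] with N hn hm
  simp only [truncTensor, Finset.mul_sum, Finset.sum_mul, mul_smul_comm, smul_mul_assoc,
    h.defect_unit_defect, ite_and, smul_ite, smul_zero]
  simp [hn, hm]

/-- The homomorphism `K(ℓ²) ⊙ A → M` determined by a Toeplitz pair. -/
def tensorMap (h : IsToeplitz α π V) : compactOperators Ell2 ⊗[ℂ] A →ₗ[ℂ] M :=
  TensorProduct.lift <| LinearMap.mk₂ ℂ (fun T a => tensor π V (T : Ell2 →L[ℂ] Ell2) a)
    (fun S T a => tendsto_nhds_unique (h.tendsto_tensor (S + T).2 a)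
      (((h.tendsto_tensor S.2 a).add (h.tendsto_tensor T.2 a)).congr fun N =>
        (truncTensor_add_left N _ _ a).symm))
    (fun c T a => tendsto_nhds_unique (h.tendsto_tensor (c • T).2 a)
      (((h.tendsto_tensor T.2 a).const_smul c).congr fun N =>
        (truncTensor_smul_left N c _ a).symm))
    (fun T a b => tendsto_nhds_unique (h.tendsto_tensor T.2 (a + b))
      (((h.tendsto_tensor T.2 a).add (h.tendsto_tensor T.2 b)).congr fun N =>
        (truncTensor_add_right N _ a b).symm))
    (fun c T a => tendsto_nhds_unique (h.tendsto_tensor T.2 (c • a))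
      (((h.tendsto_tensor T.2 a).const_smul c).congr fun N =>
        (truncTensor_smul_right N c _ a).symm))

theorem tensorMap_tmul (h : IsToeplitz α π V) (T : compactOperators Ell2) (a : A) :
    h.tensorMap (T ⊗ₜ[ℂ] a) = tensor π V (T : Ell2 →L[ℂ] Ell2) a := rfl

/-- Compressions by the defect realise the slice maps along matrix coefficients, followed by the
injective map `a ↦ π(a) (1 - V₁* V₁)`; matrix coefficients separate operators. -/
theorem tensorMap_injective (h : IsToeplitz α π V) (hπ : ∀ a, π a * defect V = 0 → a = 0) :
    Function.Injective h.tensorMap := by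
  refine injective_of_slice Ell2.coeffₗ (fun T hT => Subtype.ext (Ell2.ext_coeff fun n m =>
    (hT (n, m)).trans (Ell2.coeff_zero n m).symm)) _ fun x hx p => hπ _ ?_
  have key : ∀ y : compactOperators Ell2 ⊗[ℂ] A,
      defect V * V p.1 * h.tensorMap y * (star (V p.2) * defect V) =
        π (TensorProduct.lid ℂ A ((Ell2.coeffₗ p).rTensor A y)) * defect V := by
    intro y
    induction y with
    | zero => simp
    | add y z hy hz => simp only [map_add, mul_add, add_mul, hy, hz]
    | tmul T a =>
      rw [h.tensorMap_tmul, h.defect_tensor_defect p.1 p.2 T.2, LinearMap.rTensor_tmul,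
        TensorProduct.lid_tmul, map_smul, smul_mul_assoc]
      rfl
  rw [← key, hx, mul_zero, zero_mul]

end IsToeplitz

/-! ### Separation of points by positive functionals and GNS representations. -/

section

open Filter Topology ComplexOrder ComplexStarModule

/-- Positive functionals separate the points of a C*-algebra. -/
theorem exists_positive_functional {A : Type*} [NonUnitalCStarAlgebra A] [PartialOrder A]
    [StarOrderedRing A] {a : A} (ha : a ≠ 0) :
    ∃ F : A →ₚ[ℂ] ℂ, F (star a * a) ≠ 0 := by
  have hmem : -(star a * a) ∉ ProperCone.positive ℝ A := by
    intro h
    have h1 : 0 ≤ -(star a * a) := h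
    have h2 : star a * a = 0 := le_antisymm (neg_nonneg.1 h1) (star_mul_self_nonneg a)
    exact ha (CStarRing.star_mul_self_eq_zero_iff a |>.1 h2)
  -- Hahn–Banach for the closed positive cone gives a real functional, nonnegative on the cone and
  -- negative at `-(a* a)`. It is then made complex linear through real and imaginary parts.
  obtain ⟨f, hf, hfa⟩ := (ProperCone.positive ℝ A).hyperplane_separation_point hmem
  let F : A →ₗ[ℂ] ℂ :=
    { toFun := fun x => (f (ℜ x : A) : ℂ) + Complex.I * (f (ℑ x : A) : ℂ)
      map_add' := fun x y => by
        simp only [map_add, AddSubgroup.coe_add, Complex.ofReal_add]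
        ring
      map_smul' := fun c x => by
        simp only [realPart_smul, imaginaryPart_smul, AddSubgroup.coe_sub, AddSubgroup.coe_add,
          selfAdjoint.val_smul, map_sub, map_add, map_smul, Complex.ofReal_sub,
          Complex.ofReal_add, smul_eq_mul, Complex.ofReal_mul, RingHom.id_apply]
        conv_rhs => rw [← Complex.re_add_im c]
        linear_combination (-(c.im : ℂ) * (f (ℑ x : A) : ℂ)) * Complex.I_sq }
  have hF : ∀ x, IsSelfAdjoint x → F x = (f x : ℂ) := fun x hx => by
    change (f (ℜ x : A) : ℂ) + Complex.I * (f (ℑ x : A) : ℂ) = _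
    rw [hx.coe_realPart, hx.imaginaryPart]
    simp
  refine ⟨PositiveLinearMap.mk₀ F fun x hx => ?_, ?_⟩
  · rw [hF x (IsSelfAdjoint.of_nonneg hx)]
    exact_mod_cast hf x hx
  · change F (star a * a) ≠ 0
    rw [hF _ (IsSelfAdjoint.star_mul_self a)]
    rw [map_neg] at hfa
    exact_mod_cast (by linarith : f (star a * a) > 0).ne'

/-- Nondegenerate representations separate the points of a C*-algebra. -/
theorem exists_nondegenerateRep {A : Type u} [NonUnitalCStarAlgebra A] {a : A} (ha : a ≠ 0) :
    ∃ (H : Type u) (_ : NormedAddCommGroup H) (_ : InnerProductSpace ℂ H) (_ : CompleteSpace H)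
      (π : A →⋆ₙₐ[ℂ] (H →L[ℂ] H)), NondegenerateRep π ∧ π a ≠ 0 := by
  let := CStarAlgebra.spectralOrder A
  let := CStarAlgebra.spectralOrderedRing A
  obtain ⟨F, hF⟩ := exists_positive_functional ha
  have hl := CStarAlgebra.increasingApproximateUnit A
  have := hl.neBot
  have hcont : Continuous F := map_continuous F
  refine ⟨F.GNS, inferInstance, inferInstance, inferInstance, F.gnsNonUnitalStarAlgHom, ?_, ?_⟩
  · rw [NondegenerateRep, ← dense_closure]
    refine UniformSpace.Completion.denseRange_coe.mono ?_
    rintro _ ⟨x, rfl⟩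
    -- A vector of the pre-Hilbert space is the limit of `x e = π(x) e` along an approximate unit,
    -- so ranges of the representation span densely.
    have hx : Tendsto (fun e : A => ((F.toPreGNS (F.ofPreGNS x * e) : F.PreGNS) : F.GNS))
        (CStarAlgebra.approximateUnit A) (𝓝 (x : F.GNS)) := by
      refine ((UniformSpace.Completion.continuous_coe F.PreGNS).tendsto x).comp ?_
      rw [tendsto_iff_norm_sub_tendsto_zero]
      have h1 : Tendsto (fun e : A => F.ofPreGNS x * e - F.ofPreGNS x)
          (CStarAlgebra.approximateUnit A) (𝓝 0) := by
        simpa using (hl.tendsto_mul_left (F.ofPreGNS x)).sub_const (F.ofPreGNS x)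
      have h2 : Continuous fun y : A => √(F (star y * y)).re := by fun_prop
      have h3 := (h2.tendsto 0).comp h1
      simp only [mul_zero, map_zero, Complex.zero_re, Real.sqrt_zero] at h3
      refine h3.congr fun e => ?_
      rw [F.preGNS_norm_def]
      rfl
    refine mem_closure_of_tendsto hx (Eventually.of_forall fun e => Submodule.subset_span ?_)
    exact ⟨F.ofPreGNS x, (F.toPreGNS e : F.PreGNS), by simp⟩
  · intro h0
    apply hF
    -- If `π(a) = 0` then `F` vanishes at `(a e)* (a e)` for every `e`; in the limit `F (a* a) = 0`,
    -- a contradiction.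
    have h1 : ∀ e : A, F (star (a * e) * (a * e)) = 0 := fun e => by
      have h2 : F.gnsNonUnitalStarAlgHom a (F.toPreGNS e : F.PreGNS) = 0 := by rw [h0]; rfl
      rw [F.gnsNonUnitalStarAlgHom_apply_coe, ← norm_eq_zero,
        UniformSpace.Completion.norm_coe] at h2
      have h3 := F.preGNS_norm_sq (F.leftMulMapPreGNS a (F.toPreGNS e))
      rw [h2] at h3
      simpa using h3.symm
    have h2 : Continuous fun y : A => F (star y * y) := by fun_prop
    exact tendsto_nhds_unique ((h2.tendsto a).comp (hl.tendsto_mul_left a))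
      (tendsto_const_nhds.congr fun e => (h1 e).symm)

end

theorem pow_surjective {A : Type*} [NonUnitalCStarAlgebra A] (α : A ≃⋆ₐ[ℂ] A) (n : ℕ) (a : A) :
    ∃ b, (α ^ n) b = a := (α ^ n).surjective a

/-- On a Hilbert space, a covariant partial-isometric representation is a Toeplitz pair. -/
theorem IsPisoCovariant.isToeplitz {A H : Type*} [NonUnitalCStarAlgebra A] [NormedAddCommGroup H]
    [InnerProductSpace ℂ H] [CompleteSpace H] {α : A ≃⋆ₐ[ℂ] A} {π : A →⋆ₙₐ[ℂ] (H →L[ℂ] H)}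
    {V : ℕ → (H →L[ℂ] H)} (h : IsPisoCovariant α π V) (hπ : NondegenerateRep π) :
    IsToeplitz α π V := by
  refine .of_isPisoCovariant h fun n => ?_
  refine ContinuousLinearMap.ext_on hπ ?_
  rintro _ ⟨a, x, rfl⟩
  -- Surjectivity of `αⁿ` puts every `π(a)` in the form `Vₙ π(b) Vₙ*`, on which `Vₙ Vₙ*` acts
  -- trivially.
  obtain ⟨b, rfl⟩ := pow_surjective α n a
  have : V n * star (V n) * π ((α ^ n) b) = π ((α ^ n) b) := by
    rw [h.covariant, ← mul_assoc, ← mul_assoc, h.rep.partialIsometry]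
  exact congrArg (fun T : H →L[ℂ] H => T x) this

/-! ### Direct sums of operators -/

theorem ext_lp {ι : Type*} {H : ι → Type*} [∀ i, NormedAddCommGroup (H i)] {f g : lp H 2}
    (h : ∀ i, f i = g i) : f = g := lp.ext (funext h)

section DirectSum

variable {ι : Type*} {H : ι → Type*} [∀ i, NormedAddCommGroup (H i)]
  [∀ i, InnerProductSpace ℂ (H i)]

theorem mapCLM_single [DecidableEq ι] (T : ∀ i, H i →L[ℂ] H i) {K : ℝ} (hK : 0 ≤ K)
    (hT : ∀ i, ‖T i‖ ≤ K) (i : ι) (x : H i) :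
    lp.mapCLM 2 T hK hT (lp.single 2 i x) = lp.single 2 i (T i x) := by
  refine ext_lp fun k => ?_
  change T k ((lp.single 2 i x : lp H 2) k) = _
  by_cases hk : k = i
  · subst hk; simp
  · rw [lp.single_apply_ne _ _ _ hk, lp.single_apply_ne _ _ _ hk, map_zero]

theorem norm_le_of_map_single [DecidableEq ι] {i : ι} {S : H i →L[ℂ] H i}
    {T : lp H 2 →L[ℂ] lp H 2} (h : ∀ x, T (lp.single 2 i x) = lp.single 2 i (S x)) :
    ‖S‖ ≤ ‖T‖ := by
  refine S.opNorm_le_bound (norm_nonneg T) fun x => ?_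
  have := T.le_opNorm (lp.single 2 i x)
  rwa [h, lp.norm_single (by norm_num), lp.norm_single (by norm_num)] at this

variable [∀ i, CompleteSpace (H i)]

theorem star_mapCLM (S T : ∀ i, H i →L[ℂ] H i) {K L : ℝ} (hK : 0 ≤ K) (hS : ∀ i, ‖S i‖ ≤ K)
    (hL : 0 ≤ L) (hT : ∀ i, ‖T i‖ ≤ L) (hST : ∀ i, star (S i) = T i) :
    star (lp.mapCLM 2 S hK hS) = lp.mapCLM 2 T hL hT := by
  symm
  rw [ContinuousLinearMap.star_eq_adjoint, ContinuousLinearMap.eq_adjoint_iff]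
  intro f g
  simp only [lp.inner_eq_tsum]
  refine tsum_congr fun i => ?_
  change ⟪T i (f i), g i⟫_ℂ = ⟪f i, S i (g i)⟫_ℂ
  rw [← hST, ContinuousLinearMap.star_eq_adjoint, ContinuousLinearMap.adjoint_inner_left]

variable {A : Type*} [NonUnitalCStarAlgebra A]

/-- The direct sum of a family of representations. -/
def directSumRep (π : ∀ i, A →⋆ₙₐ[ℂ] (H i →L[ℂ] H i)) : A →⋆ₙₐ[ℂ] (lp H 2 →L[ℂ] lp H 2) where
  toFun a := lp.mapCLM 2 (fun i => π i a) (norm_nonneg a)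
    fun i => NonUnitalStarAlgHom.norm_apply_le (π i) a
  map_smul' c a := by
    ext1 f
    refine ext_lp fun i => ?_
    change π i (c • a) (f i) = c • π i a (f i)
    rw [map_smul]; rfl
  map_zero' := by
    ext1 f
    refine ext_lp fun i => ?_
    change π i 0 (f i) = 0
    rw [map_zero]; rfl
  map_add' a b := by
    ext1 f
    refine ext_lp fun i => ?_
    change π i (a + b) (f i) = π i a (f i) + π i b (f i)
    rw [map_add]; rfl
  map_mul' a b := by
    ext1 f
    refine ext_lp fun i => ?_
    change π i (a * b) (f i) = π i a (π i b (f i))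
    rw [map_mul]; rfl
  map_star' a := (star_mapCLM _ _ _ _ _ _ fun i => (map_star (π i) a).symm).symm

theorem directSumRep_single [DecidableEq ι] (π : ∀ i, A →⋆ₙₐ[ℂ] (H i →L[ℂ] H i)) (a : A) (i : ι)
    (x : H i) : directSumRep π a (lp.single 2 i x) = lp.single 2 i (π i a x) :=
  mapCLM_single _ (norm_nonneg a) (fun i => NonUnitalStarAlgHom.norm_apply_le (π i) a) i x

theorem nondegenerateRep_directSumRep {π : ∀ i, A →⋆ₙₐ[ℂ] (H i →L[ℂ] H i)}
    (hπ : ∀ i, NondegenerateRep (π i)) : NondegenerateRep (directSumRep π) := by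
  classical
  rw [NondegenerateRep, Submodule.dense_iff_topologicalClosure_eq_top, eq_top_iff]
  set W := (Submodule.span ℂ {x : lp H 2 | ∃ a h, x = directSumRep π a h}).topologicalClosure
  have hW : IsClosed (W : Set (lp H 2)) := Submodule.isClosed_topologicalClosure _
  have hsingle : ∀ i (x : H i), lp.single 2 i x ∈ W := by
    intro i x
    have hle : (Submodule.span ℂ {x : H i | ∃ a h, x = π i a h}) ≤
        W.comap (lp.lsingle (𝕜 := ℂ) (E := H) 2 i) := by
      rw [Submodule.span_le]
      rintro _ ⟨a, h, rfl⟩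
      refine Submodule.le_topologicalClosure _ (Submodule.subset_span ⟨a, lp.single 2 i h, ?_⟩)
      exact (directSumRep_single π a i h).symm
    have hcl : IsClosed {x : H i | (lp.single 2 i x : lp H 2) ∈ W} :=
      hW.preimage (lp.isometry_single (p := 2) (E := H) i).continuous
    exact (hcl.closure_subset_iff.2 hle) (hπ i x)
  intro f _
  refine hW.mem_of_tendsto (lp.hasSum_single (by norm_num) f) (Eventually.of_forall fun s => ?_)
  exact W.sum_mem fun i _ => hsingle i _

end DirectSum

/-! ### The Toeplitz pair on `ℓ²(ℕ, H)` -/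

section Shift

/-- The backward shift by `k` on `ℓ²(ℕ, H)`. -/
def backShift (H : Type*) [NormedAddCommGroup H] [InnerProductSpace ℂ H] (k : ℕ) :
    lp (fun _ : ℕ => H) 2 →L[ℂ] lp (fun _ : ℕ => H) 2 :=
  LinearMap.mkContinuous
    { toFun := fun f => ⟨fun n => f (n + k), memℓp_gen <|
        ((lp.memℓp f).summable (by norm_num)).comp_injective (add_left_injective k)⟩
      map_add' := fun _ _ => rfl
      map_smul' := fun _ _ => rfl } 1 fun f => by
    rw [one_mul]
    have h2 : (0 : ℝ) < (2 : ENNReal).toReal := by norm_num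
    refine lp.norm_le_of_tsum_le h2 (norm_nonneg f) ?_
    rw [lp.norm_rpow_eq_tsum h2]
    exact tsum_comp_le_tsum_of_inj ((lp.memℓp f).summable h2) (fun _ => by positivity)
      (add_left_injective k)

variable {H : Type*} [NormedAddCommGroup H] [InnerProductSpace ℂ H]

theorem backShift_apply (k n : ℕ) (f : lp (fun _ : ℕ => H) 2) :
    backShift H k f n = f (n + k) := rfl

theorem backShift_single_add (k n : ℕ) (x : H) :
    backShift H k (lp.single 2 (n + k) x) = lp.single 2 n x := by
  refine ext_lp fun m => ?_
  rw [backShift_apply, lp.single_apply, lp.single_apply]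
  by_cases hm : m = n
  · subst hm; simp
  · rw [Pi.single_eq_of_ne (by omega), Pi.single_eq_of_ne hm]

variable [CompleteSpace H]

theorem star_backShift_apply (k n : ℕ) (f : lp (fun _ : ℕ => H) 2) :
    star (backShift H k) f (n + k) = f n := by
  refine ext_inner_left ℂ fun x => ?_
  have h1 := lp.inner_single_left (𝕜 := ℂ) (n + k) x (star (backShift H k) f)
  have h2 := lp.inner_single_left (𝕜 := ℂ) n x f
  rw [← h1, ← h2, ContinuousLinearMap.star_eq_adjoint, ContinuousLinearMap.adjoint_inner_right,
    backShift_single_add]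

variable {A : Type*} [NonUnitalCStarAlgebra A] (α : A ≃⋆ₐ[ℂ] A) (π : A →⋆ₙₐ[ℂ] (H →L[ℂ] H))

/-- The representation `(π₀(a) f)(n) = π(αⁿ a) f(n)` on `ℓ²(ℕ, H)`. -/
def orbitRep : A →⋆ₙₐ[ℂ] (lp (fun _ : ℕ => H) 2 →L[ℂ] lp (fun _ : ℕ => H) 2) :=
  directSumRep fun n : ℕ => π.comp ((α ^ n : A ≃⋆ₐ[ℂ] A) : A →⋆ₙₐ[ℂ] A)

theorem orbitRep_apply (a : A) (f : lp (fun _ : ℕ => H) 2) (n : ℕ) :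
    orbitRep α π a f n = π ((α ^ n) a) (f n) := rfl

/-- The backward shift is a coisometry, and the twist by `αⁿ` in coordinate `n` exactly compensates
the shift of coordinates. -/
theorem isToeplitz_orbitRep : IsToeplitz α (orbitRep α π) (backShift H) where
  rep_zero := rfl
  rep_add n m := by
    ext1 f
    refine ext_lp fun k => ?_
    change f (k + (n + m)) = f (k + n + m)
    rw [add_assoc]
  mul_star n := by
    ext1 f
    refine ext_lp fun k => ?_
    exact star_backShift_apply n k f
  intertwine n a := by
    ext1 f
    refine ext_lp fun k => ?_
    change π ((α ^ (k + n)) a) (f (k + n)) = π ((α ^ k) ((α ^ n) a)) (f (k + n))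
    rw [pow_add]; rfl

variable {π} in
theorem nondegenerateRep_orbitRep (hπ : NondegenerateRep π) : NondegenerateRep (orbitRep α π) := by
  refine nondegenerateRep_directSumRep fun n => hπ.mono (Submodule.span_mono ?_)
  rintro _ ⟨a, x, rfl⟩
  obtain ⟨b, rfl⟩ := pow_surjective α n a
  exact ⟨b, x, rfl⟩

-- The defect fixes vectors supported at coordinate zero, where `orbitRep` acts as `π` itself.
variable {π} in
theorem orbitRep_mul_defect_ne_zero {a : A} (ha : π a ≠ 0) :
    orbitRep α π a * defect (backShift H) ≠ 0 := by
  intro h0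
  refine ha (ContinuousLinearMap.ext fun x => ?_)
  have h1 : backShift H 1 (lp.single 2 0 x) = 0 := by
    refine ext_lp fun m => ?_
    rw [backShift_apply, lp.single_apply_ne _ _ _ (by omega)]; rfl
  have h2 : defect (backShift H) (lp.single 2 0 x) = lp.single 2 0 x := by
    rw [defect, sub_apply, mul_apply_eq_comp, h1]
    simp
  have h3 := congrArg (fun T => (T (lp.single 2 0 x : lp (fun _ : ℕ => H) 2)) 0) h0
  simp only [mul_apply_eq_comp, h2, orbitRep_apply] at h3
  rw [lp.single_apply_self] at h3
  exact h3

end Shift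

/-- Every nonzero element of `A` is detected on the defect space of some covariant
partial-isometric representation. -/
theorem exists_isPisoCovariant_mul_defect_ne_zero {A : Type u} [NonUnitalCStarAlgebra A]
    (α : A ≃⋆ₐ[ℂ] A) {a : A} (ha : a ≠ 0) :
    ∃ (H : Type u) (_ : NormedAddCommGroup H) (_ : InnerProductSpace ℂ H) (_ : CompleteSpace H)
      (π : A →⋆ₙₐ[ℂ] (H →L[ℂ] H)) (V : ℕ → (H →L[ℂ] H)),
      NondegenerateRep π ∧ IsPisoCovariant α π V ∧ π a * defect V ≠ 0 := by
  obtain ⟨H, _, _, _, π, hπ, hπa⟩ := exists_nondegenerateRep ha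
  exact ⟨lp (fun _ : ℕ => H) 2, inferInstance, inferInstance, inferInstance, orbitRep α π,
    backShift H, nondegenerateRep_orbitRep α hπ, (isToeplitz_orbitRep α π).isPisoCovariant,
    orbitRep_mul_defect_ne_zero α hπa⟩

/-! ### Multipliers -/

section Multiplier

variable {B M : Type*} [NonUnitalCStarAlgebra B] [CStarAlgebra M]

theorem eq_of_forall_mul_left {b c : B} (h : ∀ x : B, x * b = x * c) : b = c := by
  rw [← sub_eq_zero, ← CStarRing.star_mul_self_eq_zero_iff, mul_sub, h, sub_self]

theorem eq_of_forall_mul_right {b c : B} (h : ∀ x : B, b * x = c * x) : b = c := by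
  rw [← sub_eq_zero, ← CStarRing.mul_star_self_eq_zero_iff, sub_mul, h, sub_self]

theorem multiplier_fst_mul (T : 𝓜(ℂ, B)) (b c : B) : T.fst (b * c) = T.fst b * c := by
  refine eq_of_forall_mul_left fun x => ?_
  rw [← T.central, ← mul_assoc, T.central, mul_assoc]

theorem multiplier_mul_snd (T : 𝓜(ℂ, B)) (b c : B) : T.snd (b * c) = b * T.snd c := by
  refine eq_of_forall_mul_right fun x => ?_
  rw [T.central, mul_assoc, ← T.central, mul_assoc]

theorem multiplier_mul_coe (T : 𝓜(ℂ, B)) (b : B) :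
    T * (b : 𝓜(ℂ, B)) = ((T.fst b : B) : 𝓜(ℂ, B)) := by
  refine DoubleCentralizer.ext _ _ _ _ (Prod.ext ?_ ?_)
  · ext x
    exact multiplier_fst_mul T b x
  · ext x
    exact T.central x b

theorem multiplier_coe_mul (T : 𝓜(ℂ, B)) (b : B) :
    (b : 𝓜(ℂ, B)) * T = ((T.snd b : B) : 𝓜(ℂ, B)) := by
  refine DoubleCentralizer.ext _ _ _ _ (Prod.ext ?_ ?_)
  · ext x
    exact (T.central b x).symm
  · ext x
    exact multiplier_mul_snd T x b

theorem multiplier_coe_injective : Function.Injective ((↑) : B → 𝓜(ℂ, B)) := fun _ _ h =>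
  eq_of_forall_mul_right fun x => congrArg (fun T : 𝓜(ℂ, B) => T.fst x) h

theorem norm_multiplier_coe (b : B) : ‖(b : 𝓜(ℂ, B))‖ = ‖b‖ :=
  NonUnitalStarAlgHom.norm_map (DoubleCentralizer.coeHom (𝕜 := ℂ) (A := B))
    multiplier_coe_injective b

/-- `x` acts on the image of `κ` as the multiplier `T` does on `B`. -/
def Implements (κ : B →⋆ₙₐ[ℂ] M) (T : 𝓜(ℂ, B)) (x : M) : Prop :=
  ∀ b, κ (T.fst b) = x * κ b ∧ κ (T.snd b) = κ b * x

namespace Implements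

variable {κ : B →⋆ₙₐ[ℂ] M} {S T : 𝓜(ℂ, B)} {x y : M}

theorem one (κ : B →⋆ₙₐ[ℂ] M) : Implements κ 1 1 := fun b => by simp

theorem coe (κ : B →⋆ₙₐ[ℂ] M) (c : B) : Implements κ (c : 𝓜(ℂ, B)) (κ c) := fun b => by
  simp

theorem mul (hS : Implements κ S x) (hT : Implements κ T y) : Implements κ (S * T) (x * y) :=
  fun b => by
    constructor
    · rw [DoubleCentralizer.mul_fst, mul_apply_eq_comp, (hS _).1, (hT _).1, mul_assoc]
    · rw [DoubleCentralizer.mul_snd, mul_apply_eq_comp, (hT _).2, (hS _).2, mul_assoc]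

theorem star (hT : Implements κ T x) : Implements κ (star T) (star x) := fun b => by
  constructor
  · rw [DoubleCentralizer.star_fst, map_star, (hT _).2, star_mul, map_star, star_star]
  · rw [DoubleCentralizer.star_snd, map_star, (hT _).1, star_mul, map_star, star_star]

/-- Carries identities from `M` to the multiplier algebra: implementation respects products and
adjoints, and with `κ` injective an element of `M` implements at most one multiplier. -/
theorem eq_left (hκ : Function.Injective κ) (hS : Implements κ S x) (hT : Implements κ T x) :
    S = T := by
  refine DoubleCentralizer.ext _ _ _ _ (Prod.ext ?_ ?_) <;> ext b <;> apply hκ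
  · exact (hS b).1.trans (hT b).1.symm
  · exact (hS b).2.trans (hT b).2.symm

/-- Carries identities in the other direction, from multipliers of `B` to multipliers of a quotient.
-/
theorem eq_right {C : Type*} [NonUnitalCStarAlgebra C] {q : B →⋆ₙₐ[ℂ] C}
    (hq : Function.Surjective q) {x y : 𝓜(ℂ, C)}
    (hx : Implements ((DoubleCentralizer.coeHom (𝕜 := ℂ) (A := C)).comp q) T x)
    (hy : Implements ((DoubleCentralizer.coeHom (𝕜 := ℂ) (A := C)).comp q) T y) : x = y := by
  refine DoubleCentralizer.ext _ _ _ _ (Prod.ext ?_ ?_) <;> ext c <;>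
    obtain ⟨b, rfl⟩ := hq c <;> apply multiplier_coe_injective
  · exact (multiplier_mul_coe x (q b)).symm.trans
      (((hx b).1.symm.trans (hy b).1).trans (multiplier_mul_coe y (q b)))
  · exact (multiplier_coe_mul x (q b)).symm.trans
      (((hx b).2.symm.trans (hy b).2).trans (multiplier_coe_mul y (q b)))

end Implements

/-- An element that multiplies the isometric image of `B` into itself gives a multiplier of `B`. -/
theorem exists_implements {κ : B →⋆ₙₐ[ℂ] M} (hκ : Function.Injective κ) {x : M}
    (hl : ∀ b, ∃ c, κ c = x * κ b) (hr : ∀ b, ∃ c, κ c = κ b * x) :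
    ∃ T : 𝓜(ℂ, B), Implements κ T x := by
  choose l hl using hl
  choose r hr using hr
  have hn := NonUnitalStarAlgHom.norm_map κ hκ
  let L : B →L[ℂ] B := LinearMap.mkContinuous
    { toFun := l
      map_add' := fun b c => hκ (by simp only [hl, map_add, mul_add])
      map_smul' := fun a b => hκ (by simp only [hl, map_smul, mul_smul_comm, RingHom.id_apply]) }
    ‖x‖ fun b => by
      change ‖l b‖ ≤ _
      rw [← hn, hl, ← hn b]
      exact norm_mul_le _ _
  let R : B →L[ℂ] B := LinearMap.mkContinuous
    { toFun := r
      map_add' := fun b c => hκ (by simp only [hr, map_add, add_mul])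
      map_smul' := fun a b => hκ (by simp only [hr, map_smul, smul_mul_assoc, RingHom.id_apply]) }
    ‖x‖ fun b => by
      change ‖r b‖ ≤ _
      rw [← hn, hr, ← hn b, mul_comm]
      exact norm_mul_le _ _
  refine ⟨⟨(L, R), fun b c => hκ ?_⟩, fun b => ⟨hl b, hr b⟩⟩
  change κ (r b * c) = κ (b * l c)
  rw [map_mul, map_mul, hl, hr, mul_assoc]

end Multiplier

/-! ### The C*-algebra generated by a Toeplitz pair -/

namespace IsToeplitz

variable {A M : Type*} [NonUnitalCStarAlgebra A] [CStarAlgebra M]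
  {α : A ≃⋆ₐ[ℂ] A} {π : A →⋆ₙₐ[ℂ] M} {V : ℕ → M}

variable (π V) in
/-- The spanning elements `Vₙ* π(a) Vₘ`. -/
def genSet : Set M := {x | ∃ n m a, x = star (V n) * π a * V m}

theorem mul_gen (h : IsToeplitz α π V) (n k m : ℕ) (a : A) :
    V n * (star (V k) * π a * V m) =
      star (V (k - n)) * π ((α ^ (n - k)) a) * V (n - k + m) := by
  calc _ = V n * star (V k) * π a * V m := by simp only [mul_assoc]
    _ = star (V (k - n)) * (V (n - k) * π a) * V m := by rw [h.mul_star_eq]; simp only [mul_assoc]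
    _ = _ := by rw [h.intertwine, h.rep_add]; simp only [mul_assoc]

theorem star_mul_gen (h : IsToeplitz α π V) (n k m : ℕ) (a : A) :
    star (V n) * (star (V k) * π a * V m) = star (V (k + n)) * π a * V m := by
  rw [← h.star_mul_star]
  simp only [mul_assoc]

/-- The linear span of the elements `Vₙ* π(a) Vₘ` is a `*`-algebra. -/
def core (h : IsToeplitz α π V) : NonUnitalStarSubalgebra ℂ M where
  __ := Submodule.span ℂ (genSet π V)
  mul_mem' {x y} hx hy := by
    induction hx using Submodule.span_induction with
    | zero => rw [zero_mul]; exact Submodule.zero_mem _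
    | add x x' _ _ hx hx' => rw [add_mul]; exact Submodule.add_mem _ hx hx'
    | smul c x _ hx => rw [smul_mul_assoc]; exact Submodule.smul_mem _ c hx
    | mem x hx =>
      obtain ⟨n, m, a, rfl⟩ := hx
      induction hy using Submodule.span_induction with
      | zero => rw [mul_zero]; exact Submodule.zero_mem _
      | add y y' _ _ hy hy' => rw [mul_add]; exact Submodule.add_mem _ hy hy'
      | smul c y _ hy => rw [mul_smul_comm]; exact Submodule.smul_mem _ c hy
      | mem y hy =>
        obtain ⟨k, l, b, rfl⟩ := hy
        exact Submodule.subset_span ⟨_, _, _, h.gen_mul_gen n m k l a b⟩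
  star_mem' {x} hx := by
    induction hx using Submodule.span_induction with
    | zero => rw [star_zero]; exact Submodule.zero_mem _
    | add x y _ _ hx hy => rw [star_add]; exact Submodule.add_mem _ hx hy
    | smul c x _ hx => rw [star_smul]; exact Submodule.smul_mem _ _ hx
    | mem x hx =>
      obtain ⟨n, m, a, rfl⟩ := hx
      exact Submodule.subset_span ⟨_, _, _, star_gen n m a⟩

/-- The C*-algebra generated by the elements `Vₙ* π(a) Vₘ`. -/
def algebra (h : IsToeplitz α π V) : NonUnitalStarSubalgebra ℂ M := h.core.topologicalClosure

instance isClosed_algebra (h : IsToeplitz α π V) : IsClosed (h.algebra : Set M) :=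
  NonUnitalStarSubalgebra.isClosed_topologicalClosure _

theorem gen_mem_algebra (h : IsToeplitz α π V) (n m : ℕ) (a : A) :
    star (V n) * π a * V m ∈ h.algebra :=
  NonUnitalStarSubalgebra.le_topologicalClosure _
    (Submodule.subset_span (⟨n, m, a, rfl⟩ : _ ∈ genSet π V))

/-- The inclusion of the algebra generated by a Toeplitz pair. -/
def incl (h : IsToeplitz α π V) : h.algebra →⋆ₙₐ[ℂ] M :=
  NonUnitalStarSubalgebraClass.subtype h.algebra

theorem incl_injective (h : IsToeplitz α π V) : Function.Injective h.incl :=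
  Subtype.val_injective

/-- The spanning elements of the algebra generated by a Toeplitz pair. -/
def gen (h : IsToeplitz α π V) (n m : ℕ) (a : A) : h.algebra :=
  ⟨star (V n) * π a * V m, h.gen_mem_algebra n m a⟩

theorem dense_span_gen (h : IsToeplitz α π V) :
    Dense (Submodule.span ℂ {b : h.algebra | ∃ n m a, b = h.gen n m a} : Set h.algebra) := by
  intro b
  rw [closure_subtype]
  have hb : (b : M) ∈ closure (Submodule.span ℂ (genSet π V) : Set M) := b.2
  refine closure_mono ?_ hb
  have : (Submodule.span ℂ (genSet π V)) ≤
      (Submodule.span ℂ {b : h.algebra | ∃ n m a, b = h.gen n m a}).map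
        (h.incl : h.algebra →ₗ[ℂ] M) := by
    rw [Submodule.span_le]
    rintro _ ⟨n, m, a, rfl⟩
    exact ⟨h.gen n m a, Submodule.subset_span ⟨n, m, a, rfl⟩, rfl⟩
  exact this

theorem mem_closed_of_gen (h : IsToeplitz α π V) {W : Submodule ℂ h.algebra}
    (hW : IsClosed (W : Set h.algebra)) (hg : ∀ n m a, h.gen n m a ∈ W) (b : h.algebra) :
    b ∈ W := by
  have hle : Submodule.span ℂ {b : h.algebra | ∃ n m a, b = h.gen n m a} ≤ W := by
    rw [Submodule.span_le]
    rintro _ ⟨n, m, a, rfl⟩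
    exact hg n m a
  exact (hW.closure_subset_iff.2 hle) (h.dense_span_gen b)

end IsToeplitz

/-- A linear map which is bounded with respect to a linear map with dense range factors through
it. -/
theorem exists_clm_extension {X E F : Type*} [AddCommGroup X] [Module ℂ X] [NormedAddCommGroup E]
    [NormedSpace ℂ E] [NormedAddCommGroup F] [NormedSpace ℂ F] [CompleteSpace F]
    (f : X →ₗ[ℂ] E) (g : X →ₗ[ℂ] F) (hf : DenseRange f) (hle : ∀ x, ‖g x‖ ≤ ‖f x‖) :
    ∃ σ : E →L[ℂ] F, ∀ x, σ (f x) = g x := by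
  obtain ⟨s, hs⟩ := f.rangeRestrict.exists_rightInverse_of_surjective f.range_rangeRestrict
  have hs' : ∀ y : LinearMap.range f, f (s y) = y := fun y =>
    congrArg Subtype.val (LinearMap.congr_fun hs y)
  let τ : LinearMap.range f →L[ℂ] F := (g ∘ₗ s).mkContinuous 1 fun y => by
    rw [one_mul]
    exact (hle (s y)).trans_eq (by rw [hs']; rfl)
  have hd : DenseRange (LinearMap.range f).subtypeL := by
    have : Set.range (LinearMap.range f).subtypeL = Set.range f := by ext y; simp
    rwa [DenseRange, this]
  have hi : IsUniformInducing (LinearMap.range f).subtypeL := isUniformEmbedding_subtype_val.1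
  refine ⟨τ.extend (LinearMap.range f).subtypeL, fun x => ?_⟩
  have h1 := τ.extend_eq hd hi (f.rangeRestrict x)
  refine h1.trans ?_
  -- The chosen preimage of `f x` differs from `x` by an element of the kernel of `f`, where the
  -- norm bound makes `g` vanish.
  have h2 : ‖g (s (f.rangeRestrict x) - x)‖ ≤ 0 := by
    refine (hle _).trans ?_
    rw [map_sub, hs']
    simp
  rw [norm_le_zero_iff, map_sub, sub_eq_zero] at h2
  exact h2

namespace IsToeplitz

/-! ### Homomorphisms out of the generated algebra. -/

section Extension

variable {A M N : Type*} [NonUnitalCStarAlgebra A] [CStarAlgebra M] [CStarAlgebra N]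
  {α : A ≃⋆ₐ[ℂ] A} {π : A →⋆ₙₐ[ℂ] M} {V : ℕ → M} {ρ : A →⋆ₙₐ[ℂ] N} {W : ℕ → N}

variable (π V) in
/-- Evaluation of formal combinations of the symbols `Vₙ* π(a) Vₘ`. -/
def eval : (ℕ × ℕ →₀ A) →ₗ[ℂ] M :=
  Finsupp.lsum ℂ fun p =>
    { toFun := fun a => star (V p.1) * π a * V p.2
      map_add' := fun a b => by rw [map_add, mul_add, add_mul]
      map_smul' := fun c a => by rw [map_smul, mul_smul_comm, smul_mul_assoc]; rfl }

theorem eval_single (n m : ℕ) (a : A) :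
    eval π V (Finsupp.single (n, m) a) = star (V n) * π a * V m := by
  simp [eval]

/-- Evaluation with values in the generated algebra. -/
def evalAlgebra (h : IsToeplitz α π V) : (ℕ × ℕ →₀ A) →ₗ[ℂ] h.algebra :=
  Finsupp.lsum ℂ fun p =>
    { toFun := fun a => h.gen p.1 p.2 a
      map_add' := fun a b => Subtype.ext (by
        change star (V p.1) * π (a + b) * V p.2 = _ + _
        rw [map_add, mul_add, add_mul]; rfl)
      map_smul' := fun c a => Subtype.ext (by
        change star (V p.1) * π (c • a) * V p.2 = c • _
        rw [map_smul, mul_smul_comm, smul_mul_assoc]; rfl) }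

theorem evalAlgebra_single (h : IsToeplitz α π V) (n m : ℕ) (a : A) :
    h.evalAlgebra (Finsupp.single (n, m) a) = h.gen n m a := by
  rw [evalAlgebra, Finsupp.lsum_single]; rfl

theorem coe_evalAlgebra (h : IsToeplitz α π V) (x : ℕ × ℕ →₀ A) :
    (h.evalAlgebra x : M) = eval π V x := by
  induction x using Finsupp.induction_linear with
  | zero => simp
  | add x y hx hy => rw [map_add, map_add, ← hx, ← hy]; rfl
  | single p a => rw [evalAlgebra_single, eval_single]; rfl

theorem denseRange_evalAlgebra (h : IsToeplitz α π V) : DenseRange h.evalAlgebra := by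
  refine h.dense_span_gen.mono ?_
  have : Submodule.span ℂ {b : h.algebra | ∃ n m a, b = h.gen n m a} ≤
      LinearMap.range h.evalAlgebra := by
    rw [Submodule.span_le]
    rintro _ ⟨n, m, a, rfl⟩
    exact ⟨_, h.evalAlgebra_single n m a⟩
  exact this

theorem gen_mul (h : IsToeplitz α π V) (n m k l : ℕ) (a b : A) :
    h.gen n m a * h.gen k l b =
      h.gen (k - m + n) (m - k + l) ((α ^ (k - m)) a * (α ^ (m - k)) b) :=
  Subtype.ext (h.gen_mul_gen n m k l a b)

theorem star_gen' (h : IsToeplitz α π V) (n m : ℕ) (a : A) :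
    star (h.gen n m a) = h.gen m n (star a) :=
  Subtype.ext (star_gen n m a)

/-- A norm inequality on formal combinations gives a homomorphism between the generated
algebras. -/
theorem exists_hom_of_norm_le (h : IsToeplitz α π V) (h' : IsToeplitz α ρ W)
    (hle : ∀ x, ‖eval ρ W x‖ ≤ ‖eval π V x‖) :
    ∃ σ : h.algebra →⋆ₙₐ[ℂ] N, ∀ n m a, σ (h.gen n m a) = star (W n) * ρ a * W m := by
  obtain ⟨σ, hσ⟩ := exists_clm_extension h.evalAlgebra (eval ρ W) h.denseRange_evalAlgebra
    fun x => (hle x).trans_eq (by rw [← h.coe_evalAlgebra]; rfl)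
  have hgen : ∀ n m a, σ (h.gen n m a) = star (W n) * ρ a * W m := fun n m a => by
    rw [← h.evalAlgebra_single, hσ, eval_single]
  -- On generators both pairs obey the same product formula; closed kernels extend this to one
  -- variable, then to the other.
  have hmul : ∀ x y, σ (x * y) = σ x * σ y := by
    intro x y
    have hx : ∀ k l b, σ (x * h.gen k l b) = σ x * σ (h.gen k l b) := by
      intro k l b
      let T : h.algebra →L[ℂ] N := σ.comp ((ContinuousLinearMap.mul ℂ h.algebra).flip
        (h.gen k l b)) - ((ContinuousLinearMap.mul ℂ N).flip (σ (h.gen k l b))).comp σ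
      have hT := h.mem_closed_of_gen (W := LinearMap.ker (T : h.algebra →ₗ[ℂ] N)) T.isClosed_ker
        (fun n m a => by
          change σ (h.gen n m a * h.gen k l b) - σ (h.gen n m a) * σ (h.gen k l b) = 0
          rw [h.gen_mul, hgen, hgen, hgen, h'.gen_mul_gen, sub_self]) x
      exact sub_eq_zero.1 hT
    let T : h.algebra →L[ℂ] N := σ.comp (ContinuousLinearMap.mul ℂ h.algebra x) -
      (ContinuousLinearMap.mul ℂ N (σ x)).comp σ
    have hT := h.mem_closed_of_gen (W := LinearMap.ker (T : h.algebra →ₗ[ℂ] N)) T.isClosed_ker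
      (fun k l b => sub_eq_zero.2 (hx k l b)) y
    exact sub_eq_zero.1 hT
  have hstar : ∀ x, σ (star x) = star (σ x) := by
    intro x
    let U : Submodule ℂ h.algebra :=
      { carrier := {x | σ (star x) = star (σ x)}
        add_mem' := fun {x y} hx hy => by
          change σ (star (x + y)) = star (σ (x + y))
          rw [star_add, map_add, map_add, star_add, hx, hy]
        zero_mem' := by
          change σ (star 0) = star (σ 0)
          rw [star_zero, map_zero, star_zero]
        smul_mem' := fun c x hx => by
          change σ (star (c • x)) = star (σ (c • x))
          rw [star_smul, map_smul, map_smul, star_smul, hx] }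
    refine h.mem_closed_of_gen (W := U) (isClosed_eq (by fun_prop) (by fun_prop))
      (fun n m a => ?_) x
    change σ (star _) = star (σ _)
    rw [h.star_gen', hgen, hgen, star_gen]
  exact ⟨{ toFun := σ, map_smul' := map_smul σ, map_zero' := map_zero σ, map_add' := map_add σ
           map_mul' := hmul, map_star' := hstar }, hgen⟩

end Extension

/-! ### Multipliers of the generated algebra -/

section Multipliers

variable {A M : Type*} [NonUnitalCStarAlgebra A] [CStarAlgebra M]
  {α : A ≃⋆ₐ[ℂ] A} {π : A →⋆ₙₐ[ℂ] M} {V : ℕ → M}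

theorem mul_mem_algebra (h : IsToeplitz α π V) {x : M}
    (hx : ∀ k m a, x * (star (V k) * π a * V m) ∈ h.algebra) (b : h.algebra) :
    x * (b : M) ∈ h.algebra := by
  let U : Submodule ℂ h.algebra :=
    { carrier := {b | x * (b : M) ∈ h.algebra}
      add_mem' := fun {b c} hb hc => by
        change x * ((b : M) + c) ∈ h.algebra
        rw [mul_add]; exact add_mem hb hc
      zero_mem' := by
        change x * (0 : M) ∈ h.algebra
        rw [mul_zero]; exact zero_mem _
      smul_mem' := fun c b hb => by
        change x * (c • (b : M)) ∈ h.algebra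
        rw [mul_smul_comm]; exact SMulMemClass.smul_mem c hb }
  have hU : IsClosed (U : Set h.algebra) :=
    h.isClosed_algebra.preimage (by fun_prop : Continuous fun b : h.algebra => x * (b : M))
  exact h.mem_closed_of_gen hU hx b

theorem V_mul_mem (h : IsToeplitz α π V) (n : ℕ) (b : h.algebra) : V n * (b : M) ∈ h.algebra :=
  h.mul_mem_algebra (fun k m a => by rw [h.mul_gen]; exact h.gen_mem_algebra _ _ _) b

theorem star_V_mul_mem (h : IsToeplitz α π V) (n : ℕ) (b : h.algebra) :
    star (V n) * (b : M) ∈ h.algebra :=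
  h.mul_mem_algebra (fun k m a => by rw [h.star_mul_gen]; exact h.gen_mem_algebra _ _ _) b

theorem mul_V_mem (h : IsToeplitz α π V) (n : ℕ) (b : h.algebra) : (b : M) * V n ∈ h.algebra := by
  have := star_mem (h.star_V_mul_mem n (star b))
  simpa using this

theorem exists_implements_V (h : IsToeplitz α π V) (n : ℕ) :
    ∃ T : 𝓜(ℂ, h.algebra), Implements h.incl T (V n) :=
  exists_implements h.incl_injective (fun b => ⟨⟨_, h.V_mul_mem n b⟩, rfl⟩)
    fun b => ⟨⟨_, h.mul_V_mem n b⟩, rfl⟩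

/-- The multiplier of the generated algebra given by `Vₙ`. -/
def mult (h : IsToeplitz α π V) (n : ℕ) : 𝓜(ℂ, h.algebra) := (h.exists_implements_V n).choose

theorem implements_mult (h : IsToeplitz α π V) (n : ℕ) : Implements h.incl (h.mult n) (V n) :=
  (h.exists_implements_V n).choose_spec

theorem π_mem_algebra (h : IsToeplitz α π V) (a : A) : π a ∈ h.algebra := by
  simpa [h.rep_zero] using h.gen_mem_algebra 0 0 a

/-- The embedding of `A` into the generated algebra. -/
def emb (h : IsToeplitz α π V) : A →⋆ₙₐ[ℂ] h.algebra where
  toFun a := ⟨π a, h.π_mem_algebra a⟩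
  map_smul' c a := Subtype.ext (map_smul π c a)
  map_zero' := Subtype.ext (map_zero π)
  map_add' a b := Subtype.ext (map_add π a b)
  map_mul' a b := Subtype.ext (map_mul π a b)
  map_star' a := Subtype.ext (map_star π a)

theorem implements_gen (h : IsToeplitz α π V) (n m : ℕ) (a : A) :
    Implements h.incl (star (h.mult n) * (h.emb a : 𝓜(ℂ, h.algebra)) * h.mult m)
      (star (V n) * π a * V m) :=
  ((h.implements_mult n).star.mul (.coe h.incl (h.emb a))).mul (h.implements_mult m)

theorem coe_gen (h : IsToeplitz α π V) (n m : ℕ) (a : A) :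
    (h.gen n m a : 𝓜(ℂ, h.algebra)) =
      star (h.mult n) * (h.emb a : 𝓜(ℂ, h.algebra)) * h.mult m :=
  Implements.eq_left h.incl_injective (.coe h.incl (h.gen n m a)) (h.implements_gen n m a)

theorem isToeplitz_mult (h : IsToeplitz α π V) :
    IsToeplitz α ((DoubleCentralizer.coeHom (𝕜 := ℂ) (A := h.algebra)).comp h.emb) h.mult where
  rep_zero := Implements.eq_left h.incl_injective (h.implements_mult 0) (h.rep_zero ▸ .one h.incl)
  rep_add n m := Implements.eq_left h.incl_injective (h.implements_mult (n + m))
    (h.rep_add n m ▸ (h.implements_mult n).mul (h.implements_mult m))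
  mul_star n := Implements.eq_left h.incl_injective ((h.implements_mult n).mul (h.implements_mult n).star)
    (h.mul_star n ▸ .one h.incl)
  intertwine n a := Implements.eq_left h.incl_injective
    ((h.implements_mult n).mul (.coe h.incl (h.emb a))) (by
      have := Implements.mul (.coe h.incl (h.emb ((α ^ n) a))) (h.implements_mult n)
      change Implements h.incl _ (π ((α ^ n) a) * V n) at this
      rw [← h.intertwine] at this
      exact this)

/-- With the coefficient written as `αⁿ a'`, an approximate unit `e` inserted next to `a'` passes
through `Vₙ*` and comes out on the left as `π(e)`. -/
theorem nondegenerateHom_emb (h : IsToeplitz α π V) : NondegenerateHom h.emb := by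
  let := CStarAlgebra.spectralOrder A
  let := CStarAlgebra.spectralOrderedRing A
  have hl := CStarAlgebra.increasingApproximateUnit A
  have := hl.neBot
  have hcl : IsClosed ((Submodule.span ℂ {x | ∃ a b, x = h.emb a * b}).topologicalClosure :
    Set h.algebra) := Submodule.isClosed_topologicalClosure _
  refine fun b => h.mem_closed_of_gen hcl (fun n m a => ?_) b
  obtain ⟨a', rfl⟩ := pow_surjective α n a
  have hlim : Tendsto (fun e => h.gen n m ((α ^ n) (e * a'))) (CStarAlgebra.approximateUnit A)
      (𝓝 (h.gen n m ((α ^ n) a'))) := by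
    rw [tendsto_subtype_rng]
    have hα : Continuous (α ^ n) := (StarAlgEquiv.isometry (α ^ n)).continuous
    have hπ : Continuous π := AddMonoidHomClass.continuous_of_bound π 1 fun a => by
      rw [one_mul]; exact NonUnitalStarAlgHom.norm_apply_le π a
    have hc : Continuous fun a : A => star (V n) * π ((α ^ n) a) * V m := by fun_prop
    exact (hc.tendsto a').comp (hl.tendsto_mul_right a')
  refine hcl.mem_of_tendsto hlim (Eventually.of_forall fun e => ?_)
  refine Submodule.le_topologicalClosure _ (Submodule.subset_span ⟨e, h.gen n m ((α ^ n) a'), ?_⟩)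
  refine Subtype.ext ?_
  change star (V n) * π ((α ^ n) (e * a')) * V m = π e * (star (V n) * π ((α ^ n) a') * V m)
  rw [map_mul, map_mul, ← mul_assoc, ← h.intertwine_star]
  simp only [mul_assoc]

theorem spanned_mult (h : IsToeplitz α π V) : Dense (Submodule.span ℂ
    {b : h.algebra | ∃ (n m : ℕ) (a : A), (b : 𝓜(ℂ, h.algebra)) =
      star (h.mult n) * (h.emb a : 𝓜(ℂ, h.algebra)) * h.mult m} : Set h.algebra) := by
  refine h.dense_span_gen.mono (Submodule.span_mono ?_)
  rintro _ ⟨n, m, a, rfl⟩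
  exact ⟨n, m, a, h.coe_gen n m a⟩

end Multipliers

end IsToeplitz

/-! ### The universal covariant representation and existence of the crossed product. -/

section

variable {A : Type u} [NonUnitalCStarAlgebra A]

/-- A covariant partial-isometric representation on a Hilbert space. -/
structure CovariantRep (α : A ≃⋆ₐ[ℂ] A) : Type (u + 1) where
  /-- the Hilbert space -/
  H : Type u
  [normed : NormedAddCommGroup H]
  [inner : InnerProductSpace ℂ H]
  [complete : CompleteSpace H]
  /-- the representation of `A` -/
  π : A →⋆ₙₐ[ℂ] (H →L[ℂ] H)
  /-- the partial isometries -/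
  V : ℕ → (H →L[ℂ] H)
  nondegenerate : NondegenerateRep π
  covariant : IsPisoCovariant α π V

namespace CovariantRep

attribute [instance] normed inner complete

variable {α : A ≃⋆ₐ[ℂ] A}

theorem isToeplitz (R : CovariantRep α) : IsToeplitz α R.π R.V :=
  R.covariant.isToeplitz R.nondegenerate

/-- The seminorm on formal combinations defined by a covariant representation. -/
def seminorm (R : CovariantRep α) (x : ℕ × ℕ →₀ A) : ℝ := ‖IsToeplitz.eval R.π R.V x‖

variable (α) in
/-- The set of all seminorms defined by covariant representations; unlike the class of the
representations themselves it is small. -/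
abbrev Index : Type u := {p : (ℕ × ℕ →₀ A) → ℝ // ∃ R : CovariantRep α, R.seminorm = p}

/-- A representation with the given seminorm. -/
def ofIndex (i : Index α) : CovariantRep α := i.2.choose

theorem seminorm_ofIndex (R : CovariantRep α) :
    (ofIndex (⟨R.seminorm, R, rfl⟩ : Index α)).seminorm = R.seminorm :=
  (⟨R.seminorm, R, rfl⟩ : Index α).2.choose_spec

variable (α) in
/-- The Hilbert space of the universal covariant representation. -/
abbrev UnivSpace : Type u := lp (fun i : Index α => (ofIndex i).H) 2

variable (α) in
/-- The representation of `A` in the universal covariant representation. -/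
def univRep : A →⋆ₙₐ[ℂ] (UnivSpace α →L[ℂ] UnivSpace α) :=
  directSumRep fun i : Index α => (ofIndex i).π

variable (α) in
/-- The partial isometries of the universal covariant representation. -/
def univV (n : ℕ) : UnivSpace α →L[ℂ] UnivSpace α :=
  lp.mapCLM 2 (fun i : Index α => (ofIndex i).V n) zero_le_one
    fun i => (ofIndex i).isToeplitz.norm_le_one n

theorem star_univV (n : ℕ) : star (univV α n) =
    lp.mapCLM 2 (fun i : Index α => star ((ofIndex i).V n)) zero_le_one
      fun i => (norm_star _).trans_le ((ofIndex i).isToeplitz.norm_le_one n) :=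
  star_mapCLM _ _ _ _ _ _ fun _ => rfl

variable (α) in
theorem isToeplitz_univ : IsToeplitz α (univRep α) (univV α) where
  rep_zero := by
    ext1 f
    refine ext_lp fun i => ?_
    exact congrArg (fun T : (ofIndex i).H →L[ℂ] (ofIndex i).H => T (f i))
      (ofIndex i).isToeplitz.rep_zero
  rep_add n m := by
    ext1 f
    refine ext_lp fun i => ?_
    exact congrArg (fun T : (ofIndex i).H →L[ℂ] (ofIndex i).H => T (f i))
      ((ofIndex i).isToeplitz.rep_add n m)
  mul_star n := by
    rw [star_univV]
    ext1 f
    refine ext_lp fun i => ?_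
    exact congrArg (fun T : (ofIndex i).H →L[ℂ] (ofIndex i).H => T (f i))
      ((ofIndex i).isToeplitz.mul_star n)
  intertwine n a := by
    ext1 f
    refine ext_lp fun i => ?_
    exact congrArg (fun T : (ofIndex i).H →L[ℂ] (ofIndex i).H => T (f i))
      ((ofIndex i).isToeplitz.intertwine n a)

theorem eval_univ_single [DecidableEq (Index α)] (x : ℕ × ℕ →₀ A) (i : Index α)
    (ξ : (ofIndex i).H) :
    IsToeplitz.eval (univRep α) (univV α) x (lp.single 2 i ξ) =
      lp.single 2 i (IsToeplitz.eval (ofIndex i).π (ofIndex i).V x ξ) := by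
  induction x using Finsupp.induction_linear with
  | zero => simp
  | add x y hx hy => simp only [map_add, add_apply, hx, hy, lp.single_add]
  | single p a =>
    rw [IsToeplitz.eval_single, IsToeplitz.eval_single, star_univV]
    simp only [mul_apply_eq_comp]
    rw [univV, mapCLM_single, univRep, directSumRep_single, mapCLM_single]

/-- `R` need not be a summand of the universal representation, but some representation with the same
seminorm is. -/
theorem norm_eval_le (R : CovariantRep α) (x : ℕ × ℕ →₀ A) :
    ‖IsToeplitz.eval R.π R.V x‖ ≤ ‖IsToeplitz.eval (univRep α) (univV α) x‖ := by
  classical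
  have h1 : ‖IsToeplitz.eval R.π R.V x‖ = _ := (congrFun R.seminorm_ofIndex x).symm
  rw [h1]
  exact norm_le_of_map_single (H := fun i : Index α => (ofIndex i).H)
    (eval_univ_single x (⟨R.seminorm, R, rfl⟩ : Index α))

end CovariantRep

/-- The algebra generated by a Toeplitz pair which dominates every covariant representation is a
partial-isometric crossed product. -/
theorem IsToeplitz.isPisoCrossedProduct {α : A ≃⋆ₐ[ℂ] A} {M : Type u} [CStarAlgebra M]
    {π : A →⋆ₙₐ[ℂ] M} {V : ℕ → M} (h : IsToeplitz α π V)
    (hu : ∀ (R : CovariantRep α) x, ‖eval R.π R.V x‖ ≤ ‖eval π V x‖) :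
    IsPisoCrossedProduct α h.emb h.mult := by
  refine ⟨h.nondegenerateHom_emb, h.isToeplitz_mult.isPisoCovariant, ?_, h.spanned_mult⟩
  intro H _ _ _ ρ W hρ hW
  have h' := hW.isToeplitz hρ
  obtain ⟨σ, hσ⟩ := h.exists_hom_of_norm_le h'
    (hu (⟨H, ρ, W, hρ, hW⟩ : CovariantRep α))
  have hj : ∀ a, σ (h.emb a) = ρ a := fun a => by
    have h1 : h.emb a = h.gen 0 0 a := Subtype.ext (by
      change _ = star (V 0) * _ * _
      rw [h.rep_zero, star_one, one_mul, mul_one]; rfl)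
    rw [h1, hσ, h'.rep_zero, star_one, one_mul, mul_one]
  have hcont : Continuous σ := AddMonoidHomClass.continuous_of_bound σ 1 fun b => by
    rw [one_mul]; exact NonUnitalStarAlgHom.norm_apply_le σ b
  refine ⟨σ, hρ.mono (Submodule.span_mono ?_), hj, fun n b => ?_⟩
  · rintro _ ⟨a, x, rfl⟩
    exact ⟨h.emb a, x, by rw [hj]⟩
  · let U : Submodule ℂ h.algebra :=
      { carrier := {b | σ ((h.mult n).fst b) = W n * σ b}
        add_mem' := fun {b c} (hb : _ = _) (hc : _ = _) => by
          change σ ((h.mult n).fst (b + c)) = W n * σ (b + c)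
          rw [map_add, map_add, map_add, mul_add, hb, hc]
        zero_mem' := by
          change σ ((h.mult n).fst 0) = W n * σ 0
          rw [map_zero, map_zero, mul_zero]
        smul_mem' := fun c b (hb : _ = _) => by
          change σ ((h.mult n).fst (c • b)) = W n * σ (c • b)
          rw [map_smul, map_smul, map_smul, hb, mul_smul_comm] }
    refine h.mem_closed_of_gen (W := U) (isClosed_eq (by fun_prop) (by fun_prop))
      (fun k m a => ?_) b
    change σ ((h.mult n).fst (h.gen k m a)) = W n * σ (h.gen k m a)
    have h1 : (h.mult n).fst (h.gen k m a) = h.gen (k - n) (n - k + m) ((α ^ (n - k)) a) :=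
      Subtype.ext (((h.implements_mult n (h.gen k m a)).1).trans (h.mul_gen n k m a))
    rw [h1, hσ, hσ, h'.mul_gen]

theorem exists_isPisoCrossedProduct (α : A ≃⋆ₐ[ℂ] A) :
    ∃ (B : Type u) (_ : NonUnitalCStarAlgebra B) (j : A →⋆ₙₐ[ℂ] B) (v : ℕ → 𝓜(ℂ, B)),
      IsPisoCrossedProduct α j v :=
  ⟨_, _, _, _, (CovariantRep.isToeplitz_univ α).isPisoCrossedProduct CovariantRep.norm_eval_le⟩

end

/-! ### Quotients of C*-algebras -/

/-- A closed self-adjoint two-sided ideal, for which the quotient norm satisfies the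
C*-inequality. -/
structure CStarIdeal (B : Type*) [NonUnitalCStarAlgebra B] where
  /-- the underlying subspace -/
  sub : Submodule ℂ B
  isClosed : IsClosed (sub : Set B)
  mul_left : ∀ x {b}, b ∈ sub → x * b ∈ sub
  mul_right : ∀ x {b}, b ∈ sub → b * x ∈ sub
  star_mem : ∀ {b}, b ∈ sub → star b ∈ sub
  cstar : ∀ b : B, ‖(Submodule.Quotient.mk b : B ⧸ sub)‖ * ‖(Submodule.Quotient.mk b : B ⧸ sub)‖ ≤
    ‖(Submodule.Quotient.mk (star b * b) : B ⧸ sub)‖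

namespace CStarIdeal

variable {B : Type*} [NonUnitalCStarAlgebra B] (J : CStarIdeal B)

/-- The quotient by a C*-ideal. -/
def Quot : Type _ := B ⧸ J.sub

instance : NormedAddCommGroup J.Quot :=
  haveI := J.isClosed
  inferInstanceAs (NormedAddCommGroup (B ⧸ J.sub))

instance : NormedSpace ℂ J.Quot := inferInstanceAs (NormedSpace ℂ (B ⧸ J.sub))

instance : CompleteSpace J.Quot := inferInstanceAs (CompleteSpace (B ⧸ J.sub))

/-- The quotient map. -/
def proj : B →ₗ[ℂ] J.Quot := J.sub.mkQ

theorem proj_surjective : Function.Surjective J.proj := J.sub.mkQ_surjective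

theorem proj_eq_zero {b : B} : J.proj b = 0 ↔ b ∈ J.sub := Submodule.Quotient.mk_eq_zero _

theorem norm_proj_le (b : B) : ‖J.proj b‖ ≤ ‖b‖ := Submodule.Quotient.norm_mk_le J.sub b

theorem exists_norm_lt (x : J.Quot) {ε : ℝ} (hε : 0 < ε) : ∃ b, J.proj b = x ∧ ‖b‖ < ‖x‖ + ε :=
  Submodule.Quotient.norm_mk_lt (S := J.sub) x hε

instance : Mul J.Quot :=
  ⟨Quotient.map₂ (· * ·) fun a b hab c d hcd => by
    have h1 := J.mul_right c ((Submodule.quotientRel_def _).1 hab)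
    have h2 := J.mul_left b ((Submodule.quotientRel_def _).1 hcd)
    refine (Submodule.quotientRel_def _).2 ?_
    have h3 := add_mem h1 h2
    rwa [sub_mul, mul_sub, sub_add_sub_cancel] at h3⟩

theorem proj_mul (b c : B) : J.proj (b * c) = J.proj b * J.proj c := rfl

instance : Star J.Quot :=
  ⟨Quotient.map star fun a b hab => by
    refine (Submodule.quotientRel_def _).2 ?_
    have h1 := J.star_mem ((Submodule.quotientRel_def _).1 hab)
    rwa [star_sub] at h1⟩

theorem proj_star (b : B) : J.proj (star b) = star (J.proj b) := rfl

instance : NonUnitalNormedRing J.Quot where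
  __ := (inferInstance : NormedAddCommGroup J.Quot)
  left_distrib := by
    intro x y z
    obtain ⟨a, rfl⟩ := J.proj_surjective x
    obtain ⟨b, rfl⟩ := J.proj_surjective y
    obtain ⟨c, rfl⟩ := J.proj_surjective z
    rw [← map_add, ← proj_mul, ← proj_mul, ← proj_mul, mul_add, map_add]
  right_distrib := by
    intro x y z
    obtain ⟨a, rfl⟩ := J.proj_surjective x
    obtain ⟨b, rfl⟩ := J.proj_surjective y
    obtain ⟨c, rfl⟩ := J.proj_surjective z
    rw [← map_add, ← proj_mul, ← proj_mul, ← proj_mul, add_mul, map_add]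
  zero_mul := by
    intro x
    obtain ⟨a, rfl⟩ := J.proj_surjective x
    rw [← map_zero J.proj, ← proj_mul, zero_mul]
  mul_zero := by
    intro x
    obtain ⟨a, rfl⟩ := J.proj_surjective x
    rw [← map_zero J.proj, ← proj_mul, mul_zero]
  mul_assoc := by
    intro x y z
    obtain ⟨a, rfl⟩ := J.proj_surjective x
    obtain ⟨b, rfl⟩ := J.proj_surjective y
    obtain ⟨c, rfl⟩ := J.proj_surjective z
    simp only [← proj_mul, mul_assoc]
  norm_mul_le := by
    intro x y
    refine le_of_forall_pos_le_add fun ε hε => ?_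
    -- Take lifts with norms within `δ` of the quotient norms and let `δ` tend to zero.
    have hlim : Tendsto (fun δ : ℝ => (‖x‖ + δ) * (‖y‖ + δ)) (𝓝[>] 0) (𝓝 (‖x‖ * ‖y‖)) := by
      have : Continuous fun δ : ℝ => (‖x‖ + δ) * (‖y‖ + δ) := by fun_prop
      simpa using (this.tendsto 0).mono_left nhdsWithin_le_nhds
    have h0 : ‖x * y‖ ≤ ‖x‖ * ‖y‖ := by
      refine ge_of_tendsto hlim ?_
      filter_upwards [self_mem_nhdsWithin] with δ hδ
      obtain ⟨a, rfl, ha⟩ := J.exists_norm_lt x hδ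
      obtain ⟨b, rfl, hb⟩ := J.exists_norm_lt y hδ
      rw [← proj_mul]
      calc _ ≤ ‖a * b‖ := J.norm_proj_le _
        _ ≤ ‖a‖ * ‖b‖ := norm_mul_le _ _
        _ ≤ _ := mul_le_mul ha.le hb.le (norm_nonneg _) ((norm_nonneg _).trans ha.le)
    linarith

instance : StarRing J.Quot where
  star_involutive := by
    intro x
    obtain ⟨a, rfl⟩ := J.proj_surjective x
    rw [← proj_star, ← proj_star, star_star]
  star_mul := by
    intro x y
    obtain ⟨a, rfl⟩ := J.proj_surjective x
    obtain ⟨b, rfl⟩ := J.proj_surjective y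
    simp only [← proj_mul, ← proj_star, star_mul]
  star_add := by
    intro x y
    obtain ⟨a, rfl⟩ := J.proj_surjective x
    obtain ⟨b, rfl⟩ := J.proj_surjective y
    simp only [← map_add, ← proj_star, star_add]

instance : NonUnitalCStarAlgebra J.Quot where
  norm_mul_self_le := by
    intro x
    obtain ⟨a, rfl⟩ := J.proj_surjective x
    exact J.cstar a
  smul_assoc := by
    intro c x y
    obtain ⟨a, rfl⟩ := J.proj_surjective x
    obtain ⟨b, rfl⟩ := J.proj_surjective y
    simp only [smul_eq_mul, ← map_smul, ← proj_mul, smul_mul_assoc]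
  smul_comm := by
    intro c x y
    obtain ⟨a, rfl⟩ := J.proj_surjective x
    obtain ⟨b, rfl⟩ := J.proj_surjective y
    simp only [smul_eq_mul, ← map_smul, ← proj_mul, mul_smul_comm]
  star_smul := by
    intro c x
    obtain ⟨a, rfl⟩ := J.proj_surjective x
    simp only [← map_smul, ← proj_star, star_smul]

/-- The quotient map as a `*`-homomorphism. -/
def mkHom : B →⋆ₙₐ[ℂ] J.Quot where
  toFun := J.proj
  map_smul' := map_smul J.proj
  map_zero' := map_zero J.proj
  map_add' := map_add J.proj
  map_mul' := J.proj_mul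
  map_star' := J.proj_star

end CStarIdeal

section Descend

variable {B C N : Type*} [NonUnitalCStarAlgebra B] [NonUnitalCStarAlgebra C]
  [NonUnitalCStarAlgebra N]

/-- Homomorphisms descend along surjective homomorphisms. -/
theorem exists_descend {q : B →⋆ₙₐ[ℂ] C} (hq : Function.Surjective q) (σ : B →⋆ₙₐ[ℂ] N)
    (hσ : ∀ b, q b = 0 → σ b = 0) : ∃ τ : C →⋆ₙₐ[ℂ] N, ∀ b, τ (q b) = σ b := by
  choose s hs using hq
  have key : ∀ b, σ (s (q b)) = σ b := fun b => by
    rw [← sub_eq_zero, ← map_sub]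
    exact hσ _ (by rw [map_sub, hs, sub_self])
  have key' : ∀ {c b}, q b = c → σ (s c) = σ b := by rintro _ b rfl; exact key b
  exact ⟨{ toFun := fun c => σ (s c)
           map_smul' := fun a c => (key' (by rw [map_smul, hs])).trans (map_smul σ a (s c))
           map_zero' := (key' (map_zero q)).trans (map_zero σ)
           map_add' := fun c d => (key' (by rw [map_add, hs, hs])).trans (map_add σ (s c) (s d))
           map_mul' := fun c d => (key' (by rw [map_mul, hs, hs])).trans (map_mul σ (s c) (s d))
           map_star' := fun c => (key' (by rw [map_star, hs])).trans (map_star σ (s c)) }, key⟩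

/-- Continuous linear maps descend along quotient maps. -/
theorem exists_descend_clm {q : B →⋆ₙₐ[ℂ] C}
    (hn : ∀ (c : C) (ε : ℝ), 0 < ε → ∃ b, q b = c ∧ ‖b‖ < ‖c‖ + ε) (L : B →L[ℂ] B)
    (hL : ∀ b, q b = 0 → q (L b) = 0) : ∃ L' : C →L[ℂ] C, ∀ b, L' (q b) = q (L b) := by
  have hq : Function.Surjective q := fun c => (hn c 1 one_pos).imp fun _ h => h.1
  choose s hs using hq
  have key : ∀ {c b}, q b = c → q (L (s c)) = q (L b) := by
    rintro _ b rfl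
    rw [← sub_eq_zero, ← map_sub, ← map_sub]
    exact hL _ (by rw [map_sub, hs, sub_self])
  refine ⟨LinearMap.mkContinuous
    { toFun := fun c => q (L (s c))
      map_add' := fun c d => (key (by rw [map_add, hs, hs])).trans
        (by rw [map_add, map_add] : q (L (s c + s d)) = _)
      map_smul' := fun a c => (key (by rw [map_smul, hs])).trans
        (by rw [map_smul, map_smul, RingHom.id_apply] : q (L (a • s c)) = _) } ‖L‖ fun c => ?_,
    fun b => key rfl⟩
  change ‖q (L (s c))‖ ≤ ‖L‖ * ‖c‖
  -- The section `s` carries no norm control, but the value is the same for any lift, so nearly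
  -- minimal lifts give the bound.
  have hlim : Tendsto (fun δ : ℝ => ‖L‖ * (‖c‖ + δ)) (𝓝[>] 0) (𝓝 (‖L‖ * ‖c‖)) := by
    have : Continuous fun δ : ℝ => ‖L‖ * (‖c‖ + δ) := by fun_prop
    simpa using (this.tendsto 0).mono_left nhdsWithin_le_nhds
  refine ge_of_tendsto hlim ?_
  filter_upwards [self_mem_nhdsWithin] with δ hδ
  obtain ⟨b, hb, hbn⟩ := hn c δ hδ
  rw [key hb]
  calc _ ≤ ‖L b‖ := NonUnitalStarAlgHom.norm_apply_le q _
    _ ≤ ‖L‖ * ‖b‖ := L.le_opNorm b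
    _ ≤ _ := by gcongr

/-- Multipliers preserving the kernel of a quotient map descend. -/
theorem exists_descend_multiplier {q : B →⋆ₙₐ[ℂ] C}
    (hn : ∀ (c : C) (ε : ℝ), 0 < ε → ∃ b, q b = c ∧ ‖b‖ < ‖c‖ + ε) (T : 𝓜(ℂ, B))
    (hl : ∀ b, q b = 0 → q (T.fst b) = 0) (hr : ∀ b, q b = 0 → q (T.snd b) = 0) :
    ∃ T' : 𝓜(ℂ, C),
      Implements ((DoubleCentralizer.coeHom (𝕜 := ℂ) (A := C)).comp q) T T' := by
  have hq : Function.Surjective q := fun c => (hn c 1 one_pos).imp fun _ h => h.1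
  obtain ⟨L, hL⟩ := exists_descend_clm hn T.fst hl
  obtain ⟨R, hR⟩ := exists_descend_clm hn T.snd hr
  let T' : 𝓜(ℂ, C) := ⟨(L, R), fun c d => by
    obtain ⟨b, rfl⟩ := hq c
    obtain ⟨b', rfl⟩ := hq d
    change R (q b) * q b' = q b * L (q b')
    rw [hL, hR, ← map_mul, ← map_mul, T.central]⟩
  refine ⟨T', fun b => ⟨?_, ?_⟩⟩
  · refine Eq.trans ?_ (multiplier_mul_coe T' (q b)).symm
    exact congrArg (fun c : C => (c : 𝓜(ℂ, C))) (hL b).symm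
  · refine Eq.trans ?_ (multiplier_coe_mul T' (q b)).symm
    exact congrArg (fun c : C => (c : 𝓜(ℂ, C))) (hR b).symm

end Descend

/-! ### The ideal generated by the defect projection -/

namespace IsToeplitz

variable {A M : Type*} [NonUnitalCStarAlgebra A] [CStarAlgebra M]
  {α : A ≃⋆ₐ[ℂ] A} {π : A →⋆ₙₐ[ℂ] M} {V : ℕ → M}

variable (V) in
/-- The elements `y` with `y V_N* → 0`. -/
def vanishing : Submodule ℂ M where
  carrier := {y | Tendsto (fun N => y * star (V N)) atTop (𝓝 0)}
  add_mem' {y z} hy hz := by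
    simpa [add_mul] using Tendsto.add hy hz
  zero_mem' := by simp
  smul_mem' c y hy := by
    simpa [smul_mul_assoc] using Tendsto.const_smul hy c

theorem mem_vanishing {y : M} :
    y ∈ vanishing V ↔ Tendsto (fun N => y * star (V N)) atTop (𝓝 0) := Iff.rfl

theorem norm_mul_star_le (h : IsToeplitz α π V) (y : M) (N : ℕ) : ‖y * star (V N)‖ ≤ ‖y‖ :=
  (norm_mul_le _ _).trans (mul_le_of_le_one_right (norm_nonneg _)
    ((norm_star _).trans_le (h.norm_le_one N)))

/-- The maps `y ↦ y V_N*` are contractions, so convergence to zero survives norm limits. -/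
theorem isClosed_vanishing (h : IsToeplitz α π V) : IsClosed (vanishing V : Set M) := by
  refine isClosed_of_closure_subset fun y hy => ?_
  change Tendsto _ _ _
  rw [Metric.tendsto_nhds]
  intro ε hε
  obtain ⟨z, hz, hyz⟩ := Metric.mem_closure_iff.1 hy (ε / 2) (by positivity)
  filter_upwards [Metric.tendsto_nhds.1 (mem_vanishing.1 hz) (ε / 2) (by positivity)] with N hN
  rw [dist_zero_right] at hN ⊢
  rw [dist_eq_norm] at hyz
  calc ‖y * star (V N)‖ = ‖(y - z) * star (V N) + z * star (V N)‖ := by rw [sub_mul]; abel_nf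
    _ ≤ ‖(y - z) * star (V N)‖ + ‖z * star (V N)‖ := norm_add_le _ _
    _ < ε / 2 + ε / 2 := add_lt_add ((h.norm_mul_star_le _ N).trans_lt hyz) hN
    _ = ε := by ring

theorem vanishing_mul_left (x : M) {y : M} (hy : y ∈ vanishing V) : x * y ∈ vanishing V := by
  have := Tendsto.const_mul x (mem_vanishing.1 hy)
  simpa [mem_vanishing, mul_assoc] using this

theorem vanishing_mul_star (h : IsToeplitz α π V) (k : ℕ) {y : M} (hy : y ∈ vanishing V) :
    y * star (V k) ∈ vanishing V := by
  refine ((mem_vanishing.1 hy).comp (tendsto_add_atTop_nat k)).congr fun N => ?_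
  rw [mul_assoc, h.star_mul_star]; rfl

theorem vanishing_mul_V (h : IsToeplitz α π V) (k : ℕ) {y : M} (hy : y ∈ vanishing V) :
    y * V k ∈ vanishing V := by
  refine mem_vanishing.2 ((tendsto_add_atTop_iff_nat k).1 ?_)
  refine (mem_vanishing.1 hy).congr fun N => ?_
  rw [mul_assoc, h.mul_star_of_le (Nat.le_add_left k N), Nat.add_sub_cancel]

/-- Moving `π(a)` past `V_N*` turns it into `π(αᴺ a)`, whose norm stays at most `‖a‖` since
automorphisms are isometric. -/
theorem vanishing_mul_π (h : IsToeplitz α π V) (a : A) {y : M} (hy : y ∈ vanishing V) :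
    y * π a ∈ vanishing V := by
  refine squeeze_zero_norm (a := fun N => ‖y * star (V N)‖ * ‖a‖) (fun N => ?_) ?_
  · rw [mul_assoc, h.intertwine_star, ← mul_assoc]
    refine (norm_mul_le _ _).trans ?_
    gcongr
    refine (NonUnitalStarAlgHom.norm_apply_le π _).trans_eq ?_
    exact StarAlgEquiv.norm_map (α ^ N) a
  · simpa using (mem_vanishing.1 hy).norm.mul_const ‖a‖

theorem unit_mem_vanishing (h : IsToeplitz α π V) (n m : ℕ) (a : A) :
    unit π V n m a ∈ vanishing V := by
  refine tendsto_const_nhds.congr' ?_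
  filter_upwards [eventually_gt_atTop m] with N hN
  rw [h.unit_mul_star_eq_zero hN]

variable (π V) in
/-- The closed span of the elements `Vₙ* π(a) (1 - V₁* V₁) Vₘ`. -/
def defectIdeal : Submodule ℂ M :=
  (Submodule.span ℂ {x | ∃ n m a, x = unit π V n m a}).topologicalClosure

theorem isClosed_defectIdeal : IsClosed (defectIdeal π V : Set M) :=
  Submodule.isClosed_topologicalClosure _

theorem unit_mem_defectIdeal (n m : ℕ) (a : A) : unit π V n m a ∈ defectIdeal π V :=
  Submodule.le_topologicalClosure _ (Submodule.subset_span ⟨n, m, a, rfl⟩)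

theorem defectIdeal_le {W : Submodule ℂ M} (hW : IsClosed (W : Set M))
    (hu : ∀ n m a, unit π V n m a ∈ W) : defectIdeal π V ≤ W := by
  refine Submodule.topologicalClosure_minimal _ (Submodule.span_le.2 ?_) hW
  rintro _ ⟨n, m, a, rfl⟩
  exact hu n m a

theorem defectIdeal_le_vanishing (h : IsToeplitz α π V) : defectIdeal π V ≤ vanishing V :=
  defectIdeal_le h.isClosed_vanishing h.unit_mem_vanishing

/-- The condition `y V_N* → 0` is one-sided; self-adjointness of the ideal is visible only from its
spanning matrix units. -/
theorem star_mem_defectIdeal (h : IsToeplitz α π V) {y : M} (hy : y ∈ defectIdeal π V) :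
    star y ∈ defectIdeal π V := by
  let W : Submodule ℂ M :=
    { carrier := {y | star y ∈ defectIdeal π V}
      add_mem' := fun {y z} hy hz => by
        change star (y + z) ∈ defectIdeal π V
        rw [star_add]; exact add_mem hy hz
      zero_mem' := by
        change star 0 ∈ defectIdeal π V
        rw [star_zero]; exact zero_mem _
      smul_mem' := fun c y hy => by
        change star (c • y) ∈ defectIdeal π V
        rw [star_smul]; exact Submodule.smul_mem _ _ hy }
  have hW : IsClosed (W : Set M) := isClosed_defectIdeal.preimage continuous_star
  refine defectIdeal_le hW (fun n m a => ?_) hy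
  change star (unit π V n m a) ∈ defectIdeal π V
  rw [h.star_unit]
  exact unit_mem_defectIdeal _ _ _

/-- `1 - V_N* V_N` is a finite sum of diagonal matrix units, and a generator times each of them is a
matrix unit with coefficient or zero. -/
theorem mul_one_sub_mem_defectIdeal (h : IsToeplitz α π V) (N : ℕ) {y : M}
    (hy : y ∈ closure (Submodule.span ℂ (genSet π V) : Set M)) :
    y * (1 - star (V N) * V N) ∈ defectIdeal π V := by
  let W : Submodule ℂ M := (defectIdeal π V).comap (LinearMap.mulRight ℂ (1 - star (V N) * V N))
  have hW : IsClosed (W : Set M) := isClosed_defectIdeal.preimage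
    (by fun_prop : Continuous fun y : M => y * (1 - star (V N) * V N))
  have hle : Submodule.span ℂ (genSet π V) ≤ W := by
    rw [Submodule.span_le]
    rintro _ ⟨n, m, a, rfl⟩
    change _ * (1 - star (V N) * V N) ∈ defectIdeal π V
    rw [h.one_sub_star_mul, Finset.mul_sum]
    refine Submodule.sum_mem _ fun k _ => ?_
    rw [h.gen_mul_unit_one]
    split_ifs
    · exact unit_mem_defectIdeal _ _ _
    · exact zero_mem _
  exact (hW.closure_subset_iff.2 hle) hy

/-- `y` is the limit of `y (1 - V_N* V_N)`, because `‖y V_N* V_N‖ = ‖y V_N*‖ → 0`. -/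
theorem mem_defectIdeal_of_mem_vanishing (h : IsToeplitz α π V) {y : M} (hy : y ∈ vanishing V)
    (hyA : y ∈ closure (Submodule.span ℂ (genSet π V) : Set M)) : y ∈ defectIdeal π V := by
  refine isClosed_defectIdeal.mem_of_tendsto (f := fun N => y * (1 - star (V N) * V N))
    (b := atTop) ?_ (Eventually.of_forall fun N => h.mul_one_sub_mem_defectIdeal N hyA)
  have h0 : Tendsto (fun N => y * star (V N) * V N) atTop (𝓝 0) := by
    refine squeeze_zero_norm (a := fun N => ‖y * star (V N)‖) (fun N => ?_)
      (by simpa using (mem_vanishing.1 hy).norm)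
    rw [h.norm_mul_right]
  have h1 := h0.const_sub y
  rw [sub_zero] at h1
  refine h1.congr fun N => ?_
  rw [mul_sub, mul_one, mul_assoc]

end IsToeplitz

theorem continuous_starHom {A B : Type*} [NonUnitalCStarAlgebra A] [NonUnitalCStarAlgebra B]
    (φ : A →⋆ₙₐ[ℂ] B) : Continuous φ :=
  AddMonoidHomClass.continuous_of_bound φ 1 fun b => by
    rw [one_mul]; exact NonUnitalStarAlgHom.norm_apply_le φ b

theorem mem_of_dense_span {E : Type*} [NormedAddCommGroup E] [NormedSpace ℂ E] {s : Set E}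
    (hs : Dense (Submodule.span ℂ s : Set E)) {W : Submodule ℂ E} (hW : IsClosed (W : Set E))
    (h : ∀ x ∈ s, x ∈ W) (x : E) : x ∈ W :=
  (hW.closure_subset_iff.2 (Submodule.span_le.2 h)) (hs x)

theorem dense_span_of_surjective {B C : Type*} [NonUnitalCStarAlgebra B]
    [NonUnitalCStarAlgebra C] {q : B →⋆ₙₐ[ℂ] C} (hq : Function.Surjective q) {s : Set B}
    {t : Set C} (hs : Dense (Submodule.span ℂ s : Set B)) (h : ∀ b ∈ s, q b ∈ t) :
    Dense (Submodule.span ℂ t : Set C) := by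
  intro c
  obtain ⟨b, rfl⟩ := hq c
  exact mem_of_dense_span hs
    (W := (Submodule.span ℂ t).topologicalClosure.comap (q : B →ₗ[ℂ] C))
    ((Submodule.isClosed_topologicalClosure _).preimage (continuous_starHom q))
    (fun b hb => Submodule.le_topologicalClosure _ (Submodule.subset_span (h b hb))) b

/-! ### Covariant pairs in a multiplier algebra. -/

section Multiplier

variable {A B : Type*} [NonUnitalCStarAlgebra A] [NonUnitalCStarAlgebra B]

/-- A homomorphism into a C*-algebra as a homomorphism into its multiplier algebra. -/
abbrev toMultiplier (j : A →⋆ₙₐ[ℂ] B) : A →⋆ₙₐ[ℂ] 𝓜(ℂ, B) :=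
  (DoubleCentralizer.coeHom (𝕜 := ℂ) (A := B)).comp j

theorem multiplier_ext_fst {S T : 𝓜(ℂ, B)} (h : ∀ b, S.fst b = T.fst b) : S = T := by
  refine DoubleCentralizer.ext _ _ _ _ (Prod.ext (ContinuousLinearMap.ext h) ?_)
  ext b
  refine eq_of_forall_mul_right fun c => ?_
  exact (S.central b c).trans ((congrArg (b * ·) (h c)).trans (T.central b c).symm)

/-- A nondegenerate representation that transforms left multiplication by `T` into left
multiplication by `x` sends `T` to `x`. -/
theorem implements_of_fst {H : Type*} [NormedAddCommGroup H] [InnerProductSpace ℂ H]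
    [CompleteSpace H] {σ : B →⋆ₙₐ[ℂ] (H →L[ℂ] H)} (hσ : NondegenerateRep σ) {T : 𝓜(ℂ, B)}
    {x : H →L[ℂ] H} (h : ∀ b, σ (T.fst b) = x * σ b) : Implements σ T x := fun b => by
  refine ⟨h b, ContinuousLinearMap.ext_on hσ ?_⟩
  rintro _ ⟨c, ξ, rfl⟩
  have : σ (T.snd b) * σ c = σ b * x * σ c := by
    rw [← map_mul, T.central, map_mul, h, mul_assoc]
  exact congrArg (fun S : H →L[ℂ] H => S ξ) this

/-- As on a Hilbert space, `vₙ vₙ*` fixes each `j(αⁿ a)`; the dense set is now the span of the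
products `j(a) c` in `B`. -/
theorem IsPisoCovariant.isToeplitz_toMultiplier {α : A ≃⋆ₐ[ℂ] A} {j : A →⋆ₙₐ[ℂ] B}
    {v : ℕ → 𝓜(ℂ, B)} (h : IsPisoCovariant α (toMultiplier j) v) (hj : NondegenerateHom j) :
    IsToeplitz α (toMultiplier j) v := by
  refine .of_isPisoCovariant h fun n => multiplier_ext_fst fun b => ?_
  rw [← sub_eq_zero]
  refine mem_of_dense_span hj
    (W := LinearMap.ker ((v n * star (v n)).fst - (1 : 𝓜(ℂ, B)).fst : B →L[ℂ] B).toLinearMap)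
    (ContinuousLinearMap.isClosed_ker _) ?_ b
  rintro _ ⟨a, c, rfl⟩
  obtain ⟨a, rfl⟩ := pow_surjective α n a
  have h1 : v n * star (v n) * toMultiplier j ((α ^ n) a) = toMultiplier j ((α ^ n) a) := by
    rw [h.covariant, ← mul_assoc, ← mul_assoc, h.rep.partialIsometry]
  have h2 : (v n * star (v n)).fst (j ((α ^ n) a)) = j ((α ^ n) a) :=
    multiplier_coe_injective ((multiplier_mul_coe _ _).symm.trans h1)
  change (v n * star (v n)).fst (j ((α ^ n) a) * c) - (1 : 𝓜(ℂ, B)).fst (j ((α ^ n) a) * c) = 0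
  rw [multiplier_fst_mul, h2, sub_eq_zero]
  simp

end Multiplier

/-! ### The defect ideal inside `B`, and its quotient norm. -/

namespace IsToeplitz

variable {A B : Type*} [NonUnitalCStarAlgebra A] [NonUnitalCStarAlgebra B]
  {α : A ≃⋆ₐ[ℂ] A} {j : A →⋆ₙₐ[ℂ] B} {v : ℕ → 𝓜(ℂ, B)}

theorem exists_coe_eq_gen (n m : ℕ) (a : A) :
    ∃ b : B, (b : 𝓜(ℂ, B)) = star (v n) * toMultiplier j a * v m := by
  refine ⟨(v m).snd ((star (v n)).fst (j a)), ?_⟩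
  rw [← multiplier_coe_mul, ← multiplier_mul_coe]
  rfl

theorem exists_coe_eq_unit (h : IsToeplitz α (toMultiplier j) v) (n m : ℕ) (a : A) :
    ∃ b : B, (b : 𝓜(ℂ, B)) = unit (toMultiplier j) v n m a := by
  obtain ⟨b, hb⟩ := exists_coe_eq_gen (j := j) (v := v) n m a
  obtain ⟨c, hc⟩ := exists_coe_eq_gen (j := j) (v := v) (1 + n) (1 + m) (α a)
  exact ⟨b - c, by rw [h.unit_eq_sub, ← hb, ← hc]; exact map_sub (DoubleCentralizer.coeHom) b c⟩

variable (j v) in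
/-- `B` is the closed span of the elements `vₙ* j(a) vₘ`. -/
def Spanned : Prop := Dense (Submodule.span ℂ
    {b : B | ∃ (n m : ℕ) (a : A), (b : 𝓜(ℂ, B)) = star (v n) * (j a : 𝓜(ℂ, B)) * v m} : Set B)

theorem Spanned.coe_mem (hs : Spanned j v) (b : B) : (b : 𝓜(ℂ, B)) ∈
    closure (Submodule.span ℂ (genSet (toMultiplier j) v) : Set 𝓜(ℂ, B)) := by
  refine mem_of_dense_span hs
    (W := (Submodule.span ℂ (genSet (toMultiplier j) v)).topologicalClosure.comap
      (DoubleCentralizer.coeHom (𝕜 := ℂ) (A := B) : B →ₗ[ℂ] 𝓜(ℂ, B)))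
    ((Submodule.isClosed_topologicalClosure _).preimage
      (continuous_starHom (DoubleCentralizer.coeHom (𝕜 := ℂ) (A := B)))) ?_ b
  rintro b ⟨n, m, a, hb⟩
  exact Submodule.le_topologicalClosure _ (Submodule.subset_span ⟨n, m, a, hb⟩)

theorem mem_defectIdeal_iff (h : IsToeplitz α (toMultiplier j) v) (hs : Spanned j v) (b : B) :
    (b : 𝓜(ℂ, B)) ∈ defectIdeal (toMultiplier j) v ↔ (b : 𝓜(ℂ, B)) ∈ vanishing v :=
  ⟨fun hb => h.defectIdeal_le_vanishing hb,
    fun hb => h.mem_defectIdeal_of_mem_vanishing hb (hs.coe_mem b)⟩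

variable (v) in
/-- The elements `b ∈ B` with `b v_N* → 0`. -/
def vanishingSub : Submodule ℂ B :=
  (vanishing v).comap (DoubleCentralizer.coeHom (𝕜 := ℂ) (A := B) : B →ₗ[ℂ] 𝓜(ℂ, B))

theorem mem_vanishingSub {b : B} : b ∈ vanishingSub v ↔ (b : 𝓜(ℂ, B)) ∈ vanishing v := Iff.rfl

theorem isClosed_vanishingSub (h : IsToeplitz α (toMultiplier j) v) :
    IsClosed (vanishingSub v : Set B) :=
  h.isClosed_vanishing.preimage
    (continuous_starHom (DoubleCentralizer.coeHom (𝕜 := ℂ) (A := B)))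

theorem coeHom_mul (b c : B) : ((b * c : B) : 𝓜(ℂ, B)) = (b : 𝓜(ℂ, B)) * (c : 𝓜(ℂ, B)) :=
  map_mul (DoubleCentralizer.coeHom (𝕜 := ℂ) (A := B)) b c

theorem coeHom_star (b : B) : ((star b : B) : 𝓜(ℂ, B)) = star (b : 𝓜(ℂ, B)) :=
  map_star (DoubleCentralizer.coeHom (𝕜 := ℂ) (A := B)) b

theorem coeHom_sub (b c : B) : ((b - c : B) : 𝓜(ℂ, B)) = (b : 𝓜(ℂ, B)) - (c : 𝓜(ℂ, B)) :=
  map_sub (DoubleCentralizer.coeHom (𝕜 := ℂ) (A := B)) b c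

theorem mul_one_sub_mem_vanishing (h : IsToeplitz α (toMultiplier j) v) (hs : Spanned j v)
    (N : ℕ) (b : B) : (b : 𝓜(ℂ, B)) * (1 - star (v N) * v N) ∈ vanishing v :=
  h.defectIdeal_le_vanishing (h.mul_one_sub_mem_defectIdeal N (hs.coe_mem b))

theorem one_sub_mul_mem_vanishing (h : IsToeplitz α (toMultiplier j) v) (hs : Spanned j v)
    (N : ℕ) (b : B) : (1 - star (v N) * v N) * (b : 𝓜(ℂ, B)) ∈ vanishing v := by
  have := h.defectIdeal_le_vanishing
    (h.star_mem_defectIdeal (h.mul_one_sub_mem_defectIdeal N (hs.coe_mem (star b))))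
  simpa only [star_mul, coeHom_star, star_star, star_sub, star_one] using this

/-- `b` and `b v_N* v_N` have the same class, and the latter has norm `‖b v_N*‖`. -/
theorem norm_mk_le (h : IsToeplitz α (toMultiplier j) v) (hs : Spanned j v) (b : B) (N : ℕ) :
    ‖(Submodule.Quotient.mk b : B ⧸ vanishingSub v)‖ ≤ ‖(b : 𝓜(ℂ, B)) * star (v N)‖ := by
  have h1 : (((star (v N) * v N).snd b : B) : 𝓜(ℂ, B)) = (b : 𝓜(ℂ, B)) * star (v N) * v N := by
    rw [← multiplier_coe_mul, mul_assoc]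
  have h2 : (Submodule.Quotient.mk b : B ⧸ vanishingSub v) =
      Submodule.Quotient.mk ((star (v N) * v N).snd b) := by
    rw [Submodule.Quotient.eq, mem_vanishingSub, coeHom_sub, h1]
    have := h.mul_one_sub_mem_vanishing hs N b
    rwa [mul_sub, mul_one, ← mul_assoc] at this
  rw [h2, ← h.norm_mul_right _ N, ← h1, norm_multiplier_coe]
  exact Submodule.Quotient.norm_mk_le _ _

/-- The ideal of the elements `b ∈ B` with `b v_N* → 0`. -/
def ideal (h : IsToeplitz α (toMultiplier j) v) (hs : Spanned j v) : CStarIdeal B where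
  sub := vanishingSub v
  isClosed := h.isClosed_vanishingSub
  mul_left x b hb := by
    rw [mem_vanishingSub, coeHom_mul]
    exact vanishing_mul_left _ hb
  mul_right x b hb := by
    refine mem_of_dense_span hs (W := (vanishingSub v).comap (LinearMap.mulLeft ℂ b))
      (h.isClosed_vanishingSub.preimage (by fun_prop : Continuous fun x : B => b * x)) ?_ x
    -- Stability under right multiplication is checked on `vₙ* j(a) vₘ`, one factor at a time.
    rintro x ⟨n, m, a, hx⟩
    change b * x ∈ vanishingSub v
    rw [mem_vanishingSub, coeHom_mul, hx, ← mul_assoc, ← mul_assoc]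
    exact h.vanishing_mul_V m (h.vanishing_mul_π a (h.vanishing_mul_star n hb))
  star_mem {b} hb := by
    rw [mem_vanishingSub, ← h.mem_defectIdeal_iff hs] at hb ⊢
    rw [coeHom_star]
    exact h.star_mem_defectIdeal hb
  cstar b := by
    refine le_of_forall_pos_le_add fun ε hε => ?_
    -- Let `c` be a nearly minimal representative of `b* b`. Then `‖b v_N*‖² = ‖v_N b* b v_N*‖ ≤ ‖c‖
    -- + ‖(b* b - c) v_N*‖`, and the last term tends to zero.
    obtain ⟨c, hc, hcn⟩ := Submodule.Quotient.norm_mk_lt (S := vanishingSub v)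
      (Submodule.Quotient.mk (star b * b)) hε
    have hy : star b * b - c ∈ vanishingSub v := (Submodule.Quotient.eq _).1 hc.symm
    refine le_trans ?_ hcn.le
    have hlim := (mem_vanishing.1 hy).norm.const_add ‖c‖
    rw [norm_zero, add_zero] at hlim
    refine ge_of_tendsto hlim (Eventually.of_forall fun N => ?_)
    have h0 := h.norm_mk_le hs b N
    have h1 : star ((b : 𝓜(ℂ, B)) * star (v N)) * ((b : 𝓜(ℂ, B)) * star (v N)) =
        v N * ((c : 𝓜(ℂ, B)) * star (v N) + ((star b * b - c : B) : 𝓜(ℂ, B)) * star (v N)) := by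
      rw [coeHom_sub, coeHom_mul, coeHom_star, star_mul, star_star]
      noncomm_ring
    calc _ ≤ ‖(b : 𝓜(ℂ, B)) * star (v N)‖ * ‖(b : 𝓜(ℂ, B)) * star (v N)‖ :=
          mul_le_mul h0 h0 (norm_nonneg _) (norm_nonneg _)
      _ = ‖v N * ((c : 𝓜(ℂ, B)) * star (v N) +
            ((star b * b - c : B) : 𝓜(ℂ, B)) * star (v N))‖ := by
          rw [← CStarRing.norm_star_mul_self, h1]
      _ ≤ ‖(c : 𝓜(ℂ, B)) * star (v N) + ((star b * b - c : B) : 𝓜(ℂ, B)) * star (v N)‖ :=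
          (norm_mul_le _ _).trans (mul_le_of_le_one_left (norm_nonneg _) (h.norm_le_one N))
      _ ≤ ‖(c : 𝓜(ℂ, B)) * star (v N)‖ + ‖((star b * b - c : B) : 𝓜(ℂ, B)) * star (v N)‖ :=
          norm_add_le _ _
      _ ≤ _ := by
          exact add_le_add_left ((h.norm_mul_star_le _ N).trans_eq (norm_multiplier_coe c)) _

end IsToeplitz

/-! ### The unitary in the multiplier algebra of the quotient. -/

namespace IsToeplitz

section Quotient

variable {A B : Type*} [NonUnitalCStarAlgebra A] [NonUnitalCStarAlgebra B]
  {α : A ≃⋆ₐ[ℂ] A} {j : A →⋆ₙₐ[ℂ] B} {v : ℕ → 𝓜(ℂ, B)}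

/-- The quotient by the ideal of the elements `b` with `b v_N* → 0`. -/
abbrev quotHom (h : IsToeplitz α (toMultiplier j) v) (hs : Spanned j v) :
    B →⋆ₙₐ[ℂ] (h.ideal hs).Quot := (h.ideal hs).mkHom

theorem quotHom_surjective (h : IsToeplitz α (toMultiplier j) v) (hs : Spanned j v) :
    Function.Surjective (h.quotHom hs) := (h.ideal hs).proj_surjective

theorem quotHom_eq_zero (h : IsToeplitz α (toMultiplier j) v) (hs : Spanned j v) {b : B} :
    h.quotHom hs b = 0 ↔ (b : 𝓜(ℂ, B)) ∈ vanishing v := (h.ideal hs).proj_eq_zero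

/-- The image of `v₁` in the multiplier algebra of the quotient is a unitary. -/
theorem exists_unitary (h : IsToeplitz α (toMultiplier j) v) (hs : Spanned j v) :
    ∃ w : unitary 𝓜(ℂ, (h.ideal hs).Quot),
      Implements (toMultiplier (h.quotHom hs)) (v 1) (w : 𝓜(ℂ, (h.ideal hs).Quot)) := by
  obtain ⟨w, hw⟩ := exists_descend_multiplier (q := h.quotHom hs)
    (fun c ε hε => (h.ideal hs).exists_norm_lt c hε) (v 1)
    (fun b hb => by
      rw [quotHom_eq_zero] at hb ⊢
      rw [← multiplier_mul_coe]
      exact vanishing_mul_left _ hb)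
    (fun b hb => by
      rw [quotHom_eq_zero] at hb ⊢
      rw [← multiplier_coe_mul]
      exact h.vanishing_mul_V 1 hb)
  refine ⟨⟨w, Unitary.mem_iff.2 ⟨?_, ?_⟩⟩, hw⟩
  · refine Implements.eq_right (h.quotHom_surjective hs) (hw.star.mul hw) fun b => ?_
    have key : ∀ c : B, (c : 𝓜(ℂ, B)) - (b : 𝓜(ℂ, B)) ∈ vanishing v →
        toMultiplier (h.quotHom hs) c = toMultiplier (h.quotHom hs) b := fun c hc => by
      rw [← coeHom_sub, ← h.quotHom_eq_zero hs, map_sub, sub_eq_zero] at hc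
      exact congrArg (fun x : (h.ideal hs).Quot => (x : 𝓜(ℂ, (h.ideal hs).Quot))) hc
    rw [one_mul, mul_one]
    constructor
    · refine key _ ?_
      rw [← multiplier_mul_coe, ← neg_mem_iff, neg_sub]
      simpa only [sub_mul, one_mul] using h.one_sub_mul_mem_vanishing hs 1 b
    · refine key _ ?_
      rw [← multiplier_coe_mul, ← neg_mem_iff, neg_sub]
      simpa only [mul_sub, mul_one] using h.mul_one_sub_mem_vanishing hs 1 b
  · have h1 := hw.mul hw.star
    rw [h.mul_star] at h1
    exact Implements.eq_right (h.quotHom_surjective hs) h1 (.one _)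

theorem eq_pow_one (h : IsToeplitz α (toMultiplier j) v) (n : ℕ) : v n = v 1 ^ n := by
  induction n with
  | zero => rw [h.rep_zero, pow_zero]
  | succ n ih => rw [h.rep_add, ih, pow_succ]

end Quotient

/-- The unitary powers together with a covariant representation form a Toeplitz pair. -/
theorem of_unitary {A M : Type*} [NonUnitalCStarAlgebra A] [CStarAlgebra M] {α : A ≃⋆ₐ[ℂ] A}
    {π : A →⋆ₙₐ[ℂ] M} {U : unitary M} (hU : ∀ a, π (α a) = (U : M) * π a * star (U : M)) :
    IsToeplitz α π fun n => (U : M) ^ n where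
  rep_zero := pow_zero _
  rep_add := pow_add _
  mul_star n := Unitary.mul_star_self_of_mem (pow_mem U.2 n)
  intertwine n := by
    have h1 : ∀ a, (U : M) * π a = π (α a) * (U : M) := fun a => by
      rw [hU, mul_assoc _ (star (U : M)), Unitary.coe_star_mul_self, mul_one]
    induction n with
    | zero => intro a; simp
    | succ n ih =>
      intro a
      rw [pow_succ, mul_assoc, h1, ← mul_assoc, ih, mul_assoc, pow_succ]
      rfl

end IsToeplitz

/-! ### The quotient as crossed product by `ℤ`, and the structure of the ideal. -/

namespace IsPisoCrossedProduct

variable {A B : Type u} [NonUnitalCStarAlgebra A] [NonUnitalCStarAlgebra B]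
  {α : A ≃⋆ₐ[ℂ] A} {j : A →⋆ₙₐ[ℂ] B} {v : ℕ → 𝓜(ℂ, B)}

theorem isToeplitz (hB : IsPisoCrossedProduct α j v) : IsToeplitz α (toMultiplier j) v :=
  hB.covariant.isToeplitz_toMultiplier hB.nondegenerate

/-- The quotient homomorphism onto the crossed product by `ℤ`. -/
abbrev quotHom (hB : IsPisoCrossedProduct α j v) :
    B →⋆ₙₐ[ℂ] (hB.isToeplitz.ideal hB.spanned).Quot := hB.isToeplitz.quotHom hB.spanned

/-- In a representation in which the `vₙ` become unitary, the elements `b` with `b v_N* → 0`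
vanish. -/
theorem eq_zero_of_vanishing {H : Type*} [NormedAddCommGroup H] [InnerProductSpace ℂ H]
    [CompleteSpace H] {σ : B →⋆ₙₐ[ℂ] (H →L[ℂ] H)} {V : ℕ → (H →L[ℂ] H)}
    (hV : ∀ n, star (V n) * V n = 1) (hσ : ∀ n, Implements σ (v n) (V n)) {b : B}
    (hb : (b : 𝓜(ℂ, B)) ∈ IsToeplitz.vanishing v) : σ b = 0 := by
  rw [← norm_le_zero_iff]
  have hlim := (IsToeplitz.mem_vanishing.1 hb).norm
  rw [norm_zero] at hlim
  refine ge_of_tendsto hlim (Eventually.of_forall fun N => ?_)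
  have h1 : ‖σ b * star (V N)‖ ≤ ‖(b : 𝓜(ℂ, B)) * star (v N)‖ := by
    rw [← ((hσ N).star b).2, multiplier_coe_mul, norm_multiplier_coe]
    exact NonUnitalStarAlgHom.norm_apply_le σ _
  have h2 : ‖V N‖ ≤ 1 := by
    have := CStarRing.norm_star_mul_self (x := V N)
    rw [hV] at this
    have h3 : ‖(1 : H →L[ℂ] H)‖ ≤ 1 := ContinuousLinearMap.norm_id_le
    nlinarith [norm_nonneg (V N)]
  calc ‖σ b‖ = ‖σ b * star (V N) * V N‖ := by rw [mul_assoc, hV, mul_one]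
    _ ≤ ‖σ b * star (V N)‖ * ‖V N‖ := norm_mul_le _ _
    _ ≤ ‖σ b * star (V N)‖ := mul_le_of_le_one_right (norm_nonneg _) h2
    _ ≤ _ := h1

/-- A covariant pair with unitary `U` gives the Toeplitz pair `n ↦ Uⁿ`. The representation of `B`
which it induces kills the ideal by `eq_zero_of_vanishing`, hence factors through the quotient. -/
theorem exists_isCrossedProduct (hB : IsPisoCrossedProduct α j v) :
    ∃ w : unitary 𝓜(ℂ, (hB.isToeplitz.ideal hB.spanned).Quot),
      IsCrossedProduct α (hB.quotHom.comp j) w := by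
  have h := hB.isToeplitz
  have hq := h.quotHom_surjective hB.spanned
  obtain ⟨w, hw⟩ := h.exists_unitary hB.spanned
  have hwn : ∀ n, Implements (toMultiplier hB.quotHom) (v n)
      ((w : 𝓜(ℂ, (hB.isToeplitz.ideal hB.spanned).Quot)) ^ n) := fun n => by
    rw [h.eq_pow_one]
    induction n with
    | zero => rw [pow_zero, pow_zero]; exact .one _
    | succ n ih => rw [pow_succ, pow_succ]; exact ih.mul hw
  have hj : ∀ a, Implements (toMultiplier hB.quotHom) (j a : 𝓜(ℂ, B))
      (toMultiplier (hB.quotHom.comp j) a) := fun a => .coe _ (j a)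
  refine ⟨w, ⟨?_, fun a => ?_, ?_, ?_⟩⟩
  · refine dense_span_of_surjective hq hB.nondegenerate ?_
    rintro _ ⟨a, b, rfl⟩
    exact ⟨a, hB.quotHom b, map_mul _ _ _⟩
  · have h1 := (hw.mul (hj a)).mul hw.star
    have h2 : v 1 * (j a : 𝓜(ℂ, B)) * star (v 1) = (j (α a) : 𝓜(ℂ, B)) :=
      (hB.covariant.covariant 1 a).symm
    rw [h2] at h1
    exact Implements.eq_right hq (hj (α a)) h1
  · intro H _ _ _ π U hπ hU
    have hV := IsToeplitz.of_unitary hU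
    obtain ⟨σ, hσ, hσj, hσv⟩ := hB.universal H π _ hπ hV.isPisoCovariant
    obtain ⟨τ, hτ⟩ := exists_descend hq σ fun b hb => eq_zero_of_vanishing
      (fun n => Unitary.star_mul_self_of_mem (pow_mem U.2 n))
      (fun n => implements_of_fst hσ (hσv n)) ((h.quotHom_eq_zero hB.spanned).1 hb)
    refine ⟨τ, hσ.mono (Submodule.span_mono ?_), fun a => (hτ (j a)).trans (hσj a), fun c => ?_⟩
    · rintro _ ⟨b, x, rfl⟩
      exact ⟨hB.quotHom b, x, by rw [hτ]⟩
    · obtain ⟨b, rfl⟩ := hq c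
      have h1 : (w : 𝓜(ℂ, (hB.isToeplitz.ideal hB.spanned).Quot)).fst (hB.quotHom b) =
          hB.quotHom ((v 1).fst b) :=
        multiplier_coe_injective ((multiplier_mul_coe _ _).symm.trans (hw b).1.symm)
      rw [h1, hτ, hτ, hσv, pow_one]
  · refine dense_span_of_surjective hq hB.spanned ?_
    rintro b ⟨n, m, a, hb⟩
    obtain ⟨a, rfl⟩ := pow_surjective α n a
    -- After writing the coefficient as `αⁿ a`, the generator is `j(a) vₙ* vₘ`, whose image carries
    -- the integer exponent `m - n`.
    refine ⟨m - n, a, ?_⟩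
    have h1 : (b : 𝓜(ℂ, B)) = (j a : 𝓜(ℂ, B)) * star (v n) * v m := by
      rw [hb]
      exact congrArg (· * v m) (h.intertwine_star n a).symm
    have h2 := ((hj a).mul (hwn n).star).mul (hwn m)
    rw [← h1] at h2
    refine (Implements.eq_right hq (.coe _ b) h2).trans ?_
    rw [zpow_sub, zpow_natCast, zpow_natCast, ← ((Commute.refl w).pow_pow m n).inv_right.eq.symm,
      mul_assoc]
    rfl

/-- The hypothesis says `j(a) = j(a) v₁* v₁`, an equation inside `B`, so every representation
supplied by universality inherits it; the backward shift representation detects any nonzero `a`. -/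
theorem eq_zero_of_mul_defect_eq_zero (hB : IsPisoCrossedProduct α j v) {a : A}
    (ha : toMultiplier j a * defect v = 0) : a = 0 := by
  by_contra h0
  obtain ⟨H, _, _, _, π, V, hπ, hV, hne⟩ := exists_isPisoCovariant_mul_defect_ne_zero α h0
  obtain ⟨σ, hσ, hσj, hσv⟩ := hB.universal H π V hπ hV
  have hi : ∀ n, Implements σ (v n) (V n) := fun n => implements_of_fst hσ (hσv n)
  refine hne ?_
  have h1 : (j a : 𝓜(ℂ, B)) = (j a : 𝓜(ℂ, B)) * (star (v 1) * v 1) := by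
    rw [← sub_eq_zero, ← mul_one_sub]; exact ha
  have h2 : j a = (star (v 1) * v 1).snd (j a) :=
    multiplier_coe_injective (h1.trans (multiplier_coe_mul _ _))
  rw [defect, mul_sub, mul_one, sub_eq_zero, ← hσj, ← (((hi 1).star.mul (hi 1)) (j a)).2, ← h2]

/-- The ideal of the partial-isometric crossed product generated by the defect projection. -/
def ideal (hB : IsPisoCrossedProduct α j v) : TwoSidedIdeal B :=
  TwoSidedIdeal.mk' ((hB.isToeplitz.ideal hB.spanned).sub : Set B) (zero_mem _) add_mem neg_mem
    (CStarIdeal.mul_left _ _) (CStarIdeal.mul_right _ _)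

theorem coe_ideal (hB : IsPisoCrossedProduct α j v) :
    (hB.ideal : Set B) = (hB.isToeplitz.ideal hB.spanned).sub := TwoSidedIdeal.coe_mk' ..

theorem mem_ideal (hB : IsPisoCrossedProduct α j v) {b : B} :
    b ∈ hB.ideal ↔ (b : 𝓜(ℂ, B)) ∈ IsToeplitz.vanishing v := TwoSidedIdeal.mem_mk' ..

theorem isClosed_ideal (hB : IsPisoCrossedProduct α j v) : IsClosed (hB.ideal : Set B) := by
  rw [coe_ideal]; exact CStarIdeal.isClosed _

/-- `B` sits isometrically, hence as a closed subspace, in its multiplier algebra. It contains the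
matrix units, so the tensor map takes values in it, and the elements `eₙₘ ⊗ a` already exhaust a
dense part of the ideal. -/
theorem exists_isTensorEmbedding (hB : IsPisoCrossedProduct α j v) :
    ∃ μ : compactOperators Ell2 ⊗[ℂ] A →ₗ[ℂ] B,
      IsTensorEmbedding μ ∧ closure (Set.range μ) = (hB.ideal : Set B) := by
  have h := hB.isToeplitz
  let κ : B →ₗ[ℂ] 𝓜(ℂ, B) := (DoubleCentralizer.coeHom (𝕜 := ℂ) (A := B) : B →ₗ[ℂ] 𝓜(ℂ, B))
  have hκ : Isometry κ := AddMonoidHomClass.isometry_of_norm κ norm_multiplier_coe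
  have hcl : IsClosed ((LinearMap.range κ : Submodule ℂ 𝓜(ℂ, B)) : Set 𝓜(ℂ, B)) := by
    rw [LinearMap.coe_range]
    exact hκ.isClosedEmbedding.isClosed_range
  have hmem : ∀ x, ∃ b, κ b = h.tensorMap x := fun x => by
    change h.tensorMap x ∈ LinearMap.range κ
    induction x with
    | zero => rw [map_zero]; exact zero_mem _
    | add x y hx hy => rw [map_add]; exact add_mem hx hy
    | tmul T a => exact h.tensor_mem hcl (fun n m a => h.exists_coe_eq_unit n m a) T.2 a
  choose f hf using hmem
  let μ : compactOperators Ell2 ⊗[ℂ] A →ₗ[ℂ] B :=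
    { toFun := f
      map_add' := fun x y => hκ.injective (by rw [map_add, hf, hf, hf, map_add])
      map_smul' := fun c x => hκ.injective (by
        rw [map_smul, hf, hf, map_smul, RingHom.id_apply]) }
  have hμ : ∀ x, κ (μ x) = h.tensorMap x := hf
  refine ⟨μ, ⟨?_, ?_, ?_⟩, ?_⟩
  · have h1 : Function.Injective (κ ∘ μ) := by
      rw [show κ ∘ μ = h.tensorMap from funext hμ]
      exact h.tensorMap_injective fun a ha => hB.eq_zero_of_mul_defect_eq_zero ha
    exact h1.of_comp
  · intro S T a b
    refine hκ.injective ((hμ _).trans ?_)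
    refine (h.tensor_mul S.2 T.2 a b).trans ?_
    refine Eq.trans ?_ (IsToeplitz.coeHom_mul _ _).symm
    exact congrArg₂ (· * ·) (hμ (S ⊗ₜ a)).symm (hμ (T ⊗ₜ b)).symm
  · intro S a
    refine hκ.injective ((hμ _).trans ?_)
    refine (h.star_tensor S.2 a).trans ?_
    exact (congrArg star (hμ (S ⊗ₜ a)).symm).trans (IsToeplitz.coeHom_star _).symm
  · refine Set.Subset.antisymm (closure_minimal ?_ hB.isClosed_ideal) fun b hb => ?_
    · rintro _ ⟨x, rfl⟩
      refine hB.mem_ideal.2 ((congrArg (· ∈ IsToeplitz.vanishing v) (hμ x)).mpr ?_)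
      induction x with
      | zero => rw [map_zero]; exact zero_mem _
      | add x y hx hy => rw [map_add]; exact add_mem hx hy
      | tmul T a => exact h.tensor_mem h.isClosed_vanishing h.unit_mem_vanishing T.2 a
    · have h1 := (h.mem_defectIdeal_iff hB.spanned b).2 (hB.mem_ideal.1 hb)
      rw [hκ.isEmbedding.isInducing.closure_eq_preimage_closure_image]
      have hW : IsToeplitz.defectIdeal (toMultiplier j) v ≤
          (LinearMap.range (κ ∘ₗ μ)).topologicalClosure := by
        refine IsToeplitz.defectIdeal_le (Submodule.isClosed_topologicalClosure _) fun n m a => ?_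
        refine Submodule.le_topologicalClosure _ ?_
        refine ⟨(⟨Ell2.matUnit n m, Ell2.isCompactOperator_matUnit n m⟩ :
          compactOperators Ell2) ⊗ₜ a, ?_⟩
        exact (hμ _).trans (h.tensor_matUnit n m a)
      have h2 := hW h1
      rw [← SetLike.mem_coe, Submodule.topologicalClosure_coe, LinearMap.coe_range,
        LinearMap.coe_comp, Set.range_comp] at h2
      exact h2

/-- The witness is `e₀₀ ⊗ a`, that is `j(a) (1 - v₁* v₁)`. -/
theorem ideal_ne_bot [Nontrivial A] (hB : IsPisoCrossedProduct α j v) : hB.ideal ≠ ⊥ := by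
  obtain ⟨a, ha⟩ := exists_ne (0 : A)
  obtain ⟨b, hb⟩ := hB.isToeplitz.exists_coe_eq_unit 0 0 a
  intro h0
  have h1 : b ∈ hB.ideal := hB.mem_ideal.2 (hb ▸ hB.isToeplitz.unit_mem_vanishing 0 0 a)
  rw [h0, TwoSidedIdeal.mem_bot] at h1
  refine ha (hB.eq_zero_of_mul_defect_eq_zero ?_)
  have h2 : IsToeplitz.unit (toMultiplier j) v 0 0 a = toMultiplier j a * defect v := by
    rw [IsToeplitz.unit, hB.isToeplitz.rep_zero, star_one, one_mul, mul_one]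
  rw [← h2, ← hb, h1]
  exact map_zero (DoubleCentralizer.coeHom (𝕜 := ℂ) (A := B))

theorem ideal_ne_top [Nontrivial A] (hB : IsPisoCrossedProduct α j v) : hB.ideal ≠ ⊤ := by
  have h := hB.isToeplitz
  obtain ⟨a, ha⟩ := exists_ne (0 : A)
  intro h0
  have h1 : j a ∈ hB.ideal := h0 ▸ TwoSidedIdeal.mem_top B
  have hlim := (IsToeplitz.mem_vanishing.1 (hB.mem_ideal.1 h1)).norm
  rw [norm_zero] at hlim
  have hinj : Function.Injective (toMultiplier j) :=
    (injective_iff_map_eq_zero _).2 fun a ha => hB.eq_zero_of_mul_defect_eq_zero (by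
      rw [ha, zero_mul])
  -- The adjoint of `j(a) v_N*` is `j(αᴺ a*) v_N`, and `j`, `αᴺ` and right multiplication by `v_N`
  -- are all isometric. So the norms cannot tend to zero.
  have hnorm : ∀ N, ‖(j a : 𝓜(ℂ, B)) * star (v N)‖ = ‖a‖ := fun N => by
    have h2 : star ((j a : 𝓜(ℂ, B)) * star (v N)) = toMultiplier j ((α ^ N) (star a)) * v N := by
      rw [← h.intertwine, map_star, star_mul, star_star]; rfl
    rw [← norm_star, h2, h.norm_mul_right, NonUnitalStarAlgHom.norm_map _ hinj,
      StarAlgEquiv.norm_map (α ^ N), norm_star]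
  simp only [hnorm] at hlim
  exact ha (norm_eq_zero.1 (tendsto_nhds_unique tendsto_const_nhds hlim))

end IsPisoCrossedProduct

end Piso

end

theorem theorem4p3 {A : Type u} [NonUnitalCStarAlgebra A] [Nontrivial A] (α : A ≃⋆ₐ[ℂ] A) :
    -- the partial-isometric crossed product exists
    (∃ (B : Type u) (_ : NonUnitalCStarAlgebra B) (j : A →⋆ₙₐ[ℂ] B)
      (v : ℕ → DoubleCentralizer ℂ B), Piso.IsPisoCrossedProduct α j v) ∧
    ∀ (B : Type u) [NonUnitalCStarAlgebra B] (j : A →⋆ₙₐ[ℂ] B) (v : ℕ → DoubleCentralizer ℂ B),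
      Piso.IsPisoCrossedProduct α j v →
      ¬ Piso.IsSimpleCStar B ∧
      ∃ I : TwoSidedIdeal B, IsClosed (I : Set B) ∧ I ≠ ⊥ ∧ I ≠ ⊤ ∧
        -- `I` is a copy of `K(ℓ²(ℕ)) ⊗ A`
        (∃ μ : TensorProduct ℂ (Piso.compactOperators Piso.Ell2) A →ₗ[ℂ] B,
          Piso.IsTensorEmbedding μ ∧ closure (Set.range μ) = (I : Set B)) ∧
        -- `B / I` is a copy of `A ×_α ℤ`
        (∃ (C : Type u) (_ : NonUnitalCStarAlgebra C) (i : A →⋆ₙₐ[ℂ] C)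
          (w : unitary (DoubleCentralizer ℂ C)), Piso.IsCrossedProduct α i w ∧
          ∃ q : B →⋆ₙₐ[ℂ] C, Function.Surjective q ∧ ∀ b, q b = 0 ↔ b ∈ I) := by
  refine ⟨Piso.exists_isPisoCrossedProduct α, fun B _ j v hB => ⟨fun hs => ?_, hB.ideal,
    hB.isClosed_ideal, hB.ideal_ne_bot, hB.ideal_ne_top, hB.exists_isTensorEmbedding, ?_⟩⟩
  · exact (hs hB.ideal hB.isClosed_ideal).elim hB.ideal_ne_bot hB.ideal_ne_top
  · obtain ⟨w, hw⟩ := hB.exists_isCrossedProduct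
    exact ⟨_, _, _, w, hw, hB.quotHom, hB.isToeplitz.quotHom_surjective hB.spanned,
      fun b => (hB.isToeplitz.quotHom_eq_zero hB.spanned).trans hB.mem_ideal.symm⟩
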